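/- \textbf{Theorem.} Let $(\mathsf{C},\diamond,I,\star,J)$ be a duoidal (2-monoidal) category with interchange law $\zeta_{A,B,C,D}:(A\star B)\diamond(C\star D)\to(A\diamond C)\star(B\diamond D)$ and unit maps $\delta:I\to I\star I$, $\theta:J\diamond J\to J$, $\zeta_0:I\to J$. Let $(\mathcal{T},\mu,\eta)$ be a bimonoidal monad on $\mathsf{C}$. That is, $\mathcal{T}$ carries a monoidal structure $(\varphi,\varphi_0)$ with respect to $(\diamond,I)$ and a comonoidal structure $(\psi,\psi_0)$ with respect to $(\star,J)$, such that $\mu$ and $\eta$ are morphisms of monoidal functors and of comonoidal functors, and for all objects $A,B,C,D$ $$\psi\circ\mathcal{T}\zeta\circ\varphi=(\varphi\star\varphi)\circ\zeta\circ(\psi\diamond\psi):\ \mathcal{T}(A\star B)\diamond\mathcal{T}(C\star D)\to\mathcal{T}(A\diamond C)\star\mathcal{T}(B\diamond D),$$ $$\psi_{I,I}\circ\mathcal{T}\delta\circ\varphi_0=(\varphi_0\star\varphi_0)\circ\delta,\qquad \psi_0\circ\mathcal{T}\theta\circ\varphi_{J,J}=\theta\circ(\psi_0\diamond\psi_0),\qquad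 \psi_0\circ\mathcal{T}\zeta_0\circ\varphi_0=\zeta_0 .$$ Let $\mathsf{C}^{\mathcal{T}}$ be the category of $\mathcal{T}$-algebras. For algebras $(V_i,v_i)$ and $(W,w)$, a map $f:V_1\diamond\cdots\diamond V_n\to W$ in $\mathsf{C}$ ($n\ge 0$) is multilinear if $w\circ\mathcal{T}f\circ\varphi=f\circ(v_1\diamond\cdots\diamond v_n)$. It is universal if it is multilinear and every multilinear map $V_1\diamond\cdots\diamond V_n\to W'$ factors through it by a unique morphism of algebras $W\to W'$. Assume that every finite sequence of algebras admits a universal multilinear map, and that universal multilinear maps are closed under composition: if $a_1,\dots,a_n$ and $b$ are universal and composable, then $b\circ(a_1\diamond\cdots\diamond a_n)$ is universal. For each pair of algebras choose a universal bilinear map $u_{V,W}:V\diamond W\to V\diamond^{\varphi}W$. Then: \begin{enumerate} \item There is a monoidal structure on $\mathsf{C}^{\mathcal{T}}$ with tensor product $\diamond^{\varphi}$ on objects and with unit the free algebra $\mathcal{T}I$, whose tensor product of morphisms, associator and unitors are compatible with those of $(\mathsf{C},\diamond,I)$ through the maps $u_{V,W}$ and $\eta_I:I\to\mathcal{T}I$.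 \item The category $\mathsf{C}^{\mathcal{T}}$ is monoidal under $\star$ and $J$, with $X\star Y$ an algebra via $\mathcal{T}(X\star Y)\xrightarrow{\psi}\mathcal{T}X\star\mathcal{T}Y\xrightarrow{x\star y}X\star Y$ and $J$ an algebra via $\psi_0$. The forgetful functor to $(\mathsf{C},\star,J)$ is strict monoidal. \item With these two structures, $(\mathsf{C}^{\mathcal{T}},\diamond^{\varphi},\mathcal{T}I,\star,J)$ is a duoidal category. Its interchange law $\zeta^{\mathcal{T}}$ and its unit map $\theta^{\mathcal{T}}:J\diamond^{\varphi}J\to J$ are the algebra morphisms determined by $$\zeta^{\mathcal{T}}_{A,B,C,D}\circ u_{A\star B,C\star D}=(u_{A,C}\star u_{B,D})\circ\zeta_{A,B,C,D},\qquad \theta^{\mathcal{T}}\circ u_{J,J}=\theta .$$ Its other unit maps are $\mathcal{T}I\xrightarrow{\mathcal{T}\delta}\mathcal{T}(I\star I)\xrightarrow{\psi_{I,I}}\mathcal{T}I\star\mathcal{T}I$ and $\mathcal{T}I\xrightarrow{\mathcal{T}\zeta_0}\mathcal{T}J\xrightarrow{\psi_0}J$. \end{enumerate} -/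

import Mathlib

open CategoryTheory

universe v u w

namespace DuoidalAlgebras



section SingleStructure

open MonoidalCategory

variable {C : Type u} [Category.{v} C]

/-- A monoidal monad: the underlying endofunctor carries a (lax) monoidal structure `φ`, and the
unit and the multiplication of the monad are morphisms of monoidal functors. -/
structure MonoidalMonad (M : MonoidalCategory C) (T : Monad C) where
  lax : T.toFunctor.LaxMonoidal
  unit_isMonoidal : NatTrans.IsMonoidal T.η
  mul_isMonoidal : NatTrans.IsMonoidal T.μ

/-- The structure map `φ₀ : I ⟶ T I`. -/
def MonoidalMonad.φ₀ {M : MonoidalCategory C} {T : Monad C} (φ : MonoidalMonad M T) : 𝟙_ C ⟶ T.obj (𝟙_ C) :=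
  φ.lax.ε

/-- The structure maps `φ : T X ⊗ T Y ⟶ T (X ⊗ Y)`. -/
def MonoidalMonad.map {M : MonoidalCategory C} {T : Monad C} (φ : MonoidalMonad M T) (X Y : C) :
    T.obj X ⊗ T.obj Y ⟶ T.obj (X ⊗ Y) :=
  φ.lax.μ X Y

/-- A comonoidal monad: the underlying endofunctor carries a comonoidal (oplax monoidal)
structure `ψ`, and the unit and the multiplication of the monad are morphisms of comonoidal
functors. -/
structure ComonoidalMonad (M : MonoidalCategory C) (T : Monad C) where
  oplax : T.toFunctor.OplaxMonoidal
  unit_counit : T.η.app (𝟙_ C) ≫ oplax.η = 𝟙 (𝟙_ C)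
  unit_tensor : ∀ X Y : C, T.η.app (X ⊗ Y) ≫ oplax.δ X Y = T.η.app X ⊗ₘ T.η.app Y
  mul_counit : T.μ.app (𝟙_ C) ≫ oplax.η = T.map oplax.η ≫ oplax.η
  mul_tensor : ∀ X Y : C, T.μ.app (X ⊗ Y) ≫ oplax.δ X Y =
    T.map (oplax.δ X Y) ≫ oplax.δ (T.obj X) (T.obj Y) ≫ (T.μ.app X ⊗ₘ T.μ.app Y)

/-- The structure map `ψ₀ : T J ⟶ J`. -/
def ComonoidalMonad.ψ₀ {M : MonoidalCategory C} {T : Monad C} (ψ : ComonoidalMonad M T) : T.obj (𝟙_ C) ⟶ 𝟙_ C :=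
  ψ.oplax.η

/-- The structure maps `ψ : T (X ⊗ Y) ⟶ T X ⊗ T Y`. -/
def ComonoidalMonad.map {M : MonoidalCategory C} {T : Monad C} (ψ : ComonoidalMonad M T) (X Y : C) :
    T.obj (X ⊗ Y) ⟶ T.obj X ⊗ T.obj Y :=
  ψ.oplax.δ X Y

/-! ### The monoidal structure on algebras over a comonoidal monad -/

namespace ComonoidalMonad

variable {M : MonoidalCategory C} {T : Monad C} (ψ : ComonoidalMonad M T)

theorem map_natural {X X' Y Y' : C} (f : X ⟶ X') (g : Y ⟶ Y') :
    ψ.map X Y ≫ (T.map f ⊗ₘ T.map g) = T.map (f ⊗ₘ g) ≫ ψ.map X' Y' :=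
  let _ := ψ.oplax
  Functor.OplaxMonoidal.δ_natural T.toFunctor f g

theorem unit_map (X Y : C) : T.η.app (X ⊗ Y) ≫ ψ.map X Y = T.η.app X ⊗ₘ T.η.app Y :=
  ψ.unit_tensor X Y

theorem mul_map (X Y : C) : T.μ.app (X ⊗ Y) ≫ ψ.map X Y =
    T.map (ψ.map X Y) ≫ ψ.map (T.obj X) (T.obj Y) ≫ (T.μ.app X ⊗ₘ T.μ.app Y) :=
  ψ.mul_tensor X Y

/-- The tensor product of two algebras, with the action
`T (X ⊗ Y) ⟶ T X ⊗ T Y ⟶ X ⊗ Y` given by `ψ` followed by the tensor product of the actions. -/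
abbrev algTensor (X Y : T.Algebra) : T.Algebra where
  A := X.A ⊗ Y.A
  a := ψ.map X.A Y.A ≫ (X.a ⊗ₘ Y.a)
  unit := by
    rw [← Category.assoc, ψ.unit_map, MonoidalCategory.tensorHom_comp_tensorHom, X.unit, Y.unit]
    exact MonoidalCategory.id_tensorHom_id _ _
  assoc := by
    rw [← Category.assoc, ψ.mul_map, Category.assoc, Category.assoc,
      MonoidalCategory.tensorHom_comp_tensorHom, X.assoc, Y.assoc,
      ← MonoidalCategory.tensorHom_comp_tensorHom, ← Category.assoc (ψ.map _ _), ψ.map_natural,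
      T.map_comp]
    simp only [Category.assoc]

/-- The unit object as an algebra, with action `ψ₀`. -/
abbrev algUnit : T.Algebra where
  A := 𝟙_ C
  a := ψ.ψ₀
  unit := ψ.unit_counit
  assoc := ψ.mul_counit

theorem algTensor_hom {X X' Y Y' : T.Algebra} (f : X ⟶ X') (g : Y ⟶ Y') :
    T.map (f.f ⊗ₘ g.f) ≫ ψ.map X'.A Y'.A ≫ (X'.a ⊗ₘ Y'.a) =
      (ψ.map X.A Y.A ≫ (X.a ⊗ₘ Y.a)) ≫ (f.f ⊗ₘ g.f) := by
  rw [← Category.assoc, ← ψ.map_natural, Category.assoc, Category.assoc,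
    MonoidalCategory.tensorHom_comp_tensorHom, MonoidalCategory.tensorHom_comp_tensorHom, f.h, g.h]

theorem algTensor_associator (X Y Z : T.Algebra) :
    T.map (α_ X.A Y.A Z.A).hom ≫ ψ.map X.A (Y.A ⊗ Z.A) ≫
        (X.a ⊗ₘ (ψ.map Y.A Z.A ≫ (Y.a ⊗ₘ Z.a))) =
      (ψ.map (X.A ⊗ Y.A) Z.A ≫ ((ψ.map X.A Y.A ≫ (X.a ⊗ₘ Y.a)) ⊗ₘ Z.a)) ≫
        (α_ X.A Y.A Z.A).hom := by
  let _ := ψ.oplax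
  have h : ψ.map (X.A ⊗ Y.A) Z.A ≫ ψ.map X.A Y.A ▷ T.obj Z.A ≫ (α_ _ _ _).hom =
      T.map (α_ X.A Y.A Z.A).hom ≫ ψ.map X.A (Y.A ⊗ Z.A) ≫ T.obj X.A ◁ ψ.map Y.A Z.A :=
    Functor.OplaxMonoidal.associativity T.toFunctor X.A Y.A Z.A
  have h1 : X.a ⊗ₘ (ψ.map Y.A Z.A ≫ (Y.a ⊗ₘ Z.a)) =
      T.obj X.A ◁ ψ.map Y.A Z.A ≫ (X.a ⊗ₘ (Y.a ⊗ₘ Z.a)) := by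
    rw [← MonoidalCategory.id_tensorHom, MonoidalCategory.tensorHom_comp_tensorHom,
      Category.id_comp]
  have h2 : (ψ.map X.A Y.A ≫ (X.a ⊗ₘ Y.a)) ⊗ₘ Z.a =
      ψ.map X.A Y.A ▷ T.obj Z.A ≫ ((X.a ⊗ₘ Y.a) ⊗ₘ Z.a) := by
    rw [← MonoidalCategory.tensorHom_id, MonoidalCategory.tensorHom_comp_tensorHom,
      Category.id_comp]
  rw [h1, h2]
  simp only [Category.assoc, MonoidalCategory.associator_naturality]
  simpa only [Category.assoc] using congrArg (· ≫ (X.a ⊗ₘ (Y.a ⊗ₘ Z.a))) h.symm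

theorem algTensor_leftUnitor (X : T.Algebra) :
    T.map (λ_ X.A).hom ≫ X.a = (ψ.map (𝟙_ C) X.A ≫ (ψ.ψ₀ ⊗ₘ X.a)) ≫ (λ_ X.A).hom := by
  let _ := ψ.oplax
  have h : ψ.map (𝟙_ C) X.A ≫ ψ.ψ₀ ▷ T.obj X.A ≫ (λ_ (T.obj X.A)).hom = T.map (λ_ X.A).hom :=
    Functor.OplaxMonoidal.left_unitality_hom T.toFunctor X.A
  rw [← h, MonoidalCategory.tensorHom_def]
  simp

theorem algTensor_rightUnitor (X : T.Algebra) :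
    T.map (ρ_ X.A).hom ≫ X.a = (ψ.map X.A (𝟙_ C) ≫ (X.a ⊗ₘ ψ.ψ₀)) ≫ (ρ_ X.A).hom := by
  let _ := ψ.oplax
  have h : ψ.map X.A (𝟙_ C) ≫ T.obj X.A ◁ ψ.ψ₀ ≫ (ρ_ (T.obj X.A)).hom = T.map (ρ_ X.A).hom :=
    Functor.OplaxMonoidal.right_unitality_hom T.toFunctor X.A
  rw [← h, MonoidalCategory.tensorHom_def']
  simp

/-- The monoidal category of algebras over a comonoidal monad. The forgetful functor to `C`
preserves the whole structure strictly. -/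
@[reducible]
def algMonoidal : MonoidalCategory T.Algebra where
  tensorObj := ψ.algTensor
  tensorUnit := ψ.algUnit
  tensorHom f g := ⟨f.f ⊗ₘ g.f, ψ.algTensor_hom f g⟩
  whiskerLeft X Y Y' f := ⟨X.A ◁ f.f, by
    have h := ψ.algTensor_hom (𝟙 X) f
    rwa [Monad.Algebra.id_f, MonoidalCategory.id_tensorHom] at h⟩
  whiskerRight {X X'} f Y := ⟨f.f ▷ Y.A, by
    have h := ψ.algTensor_hom f (𝟙 Y)
    rwa [Monad.Algebra.id_f, MonoidalCategory.tensorHom_id] at h⟩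
  associator X Y Z := Monad.Algebra.isoMk (α_ X.A Y.A Z.A) (ψ.algTensor_associator X Y Z)
  leftUnitor X := Monad.Algebra.isoMk (λ_ X.A) (ψ.algTensor_leftUnitor X)
  rightUnitor X := Monad.Algebra.isoMk (ρ_ X.A) (ψ.algTensor_rightUnitor X)
  tensorHom_def f g := Monad.Algebra.Hom.ext (MonoidalCategory.tensorHom_def f.f g.f)
  id_tensorHom_id X Y := Monad.Algebra.Hom.ext (MonoidalCategory.id_tensorHom_id X.A Y.A)
  tensorHom_comp_tensorHom f g h k :=
    Monad.Algebra.Hom.ext (MonoidalCategory.tensorHom_comp_tensorHom f.f g.f h.f k.f)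
  whiskerLeft_id X Y := Monad.Algebra.Hom.ext (MonoidalCategory.whiskerLeft_id X.A Y.A)
  id_whiskerRight X Y := Monad.Algebra.Hom.ext (MonoidalCategory.id_whiskerRight X.A Y.A)
  associator_naturality f g h :=
    Monad.Algebra.Hom.ext (MonoidalCategory.associator_naturality f.f g.f h.f)
  leftUnitor_naturality f := Monad.Algebra.Hom.ext (MonoidalCategory.leftUnitor_naturality f.f)
  rightUnitor_naturality f := Monad.Algebra.Hom.ext (MonoidalCategory.rightUnitor_naturality f.f)
  pentagon W X Y Z := Monad.Algebra.Hom.ext (MonoidalCategory.pentagon W.A X.A Y.A Z.A)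
  triangle X Y := Monad.Algebra.Hom.ext (MonoidalCategory.triangle X.A Y.A)

end ComonoidalMonad

/-! ### Multilinear maps of algebras over a monoidal monad -/

section Tensor

variable (M : MonoidalCategory C) {ι : Type w}

/-- The tensor product `F i₁ ⊗ ⋯ ⊗ F iₙ` of a finite sequence of objects, bracketed to the right.
It is the unit object for `n = 0` and `F i₁` for `n = 1`. -/
def tens (F : ι → C) : List ι → C
  | [] => 𝟙_ C
  | [i] => F i
  | i :: j :: L => F i ⊗ tens F (j :: L)

/-- The canonical isomorphism `F i₁ ⊗ ⋯ ⊗ F iₙ ≅ F i₁ ⊗ (F i₂ ⊗ ⋯ ⊗ F iₙ)`. -/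
def tensCons (F : ι → C) (i : ι) : (L : List ι) → (tens M F (i :: L) ≅ F i ⊗ tens M F L)
  | [] => (ρ_ (F i)).symm
  | _ :: _ => Iso.refl _

/-- The canonical map from the tensor product of a concatenation to the tensor product of the two
tensor products, built from the associativity and unit constraints. -/
def tensAppend (F : ι → C) : (L K : List ι) → (tens M F (L ++ K) ⟶ tens M F L ⊗ tens M F K)
  | [], K => (λ_ (tens M F K)).inv
  | i :: L, K => (tensCons M F i (L ++ K)).hom ≫ F i ◁ tensAppend F L K ≫
      (α_ _ _ _).inv ≫ (tensCons M F i L).inv ▷ tens M F K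

/-- The tensor product `F i₁ ⊗ ⋯ ⊗ F iₙ ⟶ G i₁ ⊗ ⋯ ⊗ G iₙ` of a family of maps. -/
def tensMap {F G : ι → C} (f : ∀ i, F i ⟶ G i) : (L : List ι) → (tens M F L ⟶ tens M G L)
  | [] => 𝟙 (𝟙_ C)
  | [i] => f i
  | i :: j :: L => f i ⊗ₘ tensMap f (j :: L)

/-- The iterated structure map `T (F i₁) ⊗ ⋯ ⊗ T (F iₙ) ⟶ T (F i₁ ⊗ ⋯ ⊗ F iₙ)` of a monoidal
monad. It is `φ₀` for `n = 0` and the identity for `n = 1`. -/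
def MonoidalMonad.iter {M : MonoidalCategory C} {T : Monad C} (φ : MonoidalMonad M T) (F : ι → C) :
    (L : List ι) → (tens M (fun i => T.obj (F i)) L ⟶ T.obj (tens M F L))
  | [] => φ.φ₀
  | [i] => 𝟙 (T.obj (F i))
  | i :: j :: L => T.obj (F i) ◁ φ.iter F (j :: L) ≫ φ.map (F i) (tens M F (j :: L))

end Tensor

namespace MonoidalMonad

variable {M : MonoidalCategory C} {T : Monad C} (φ : MonoidalMonad M T)

/-- A map `f : V₁ ⊗ ⋯ ⊗ Vₙ ⟶ W` from a tensor product of algebras to an algebra is `n`-linear if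
`T V₁ ⊗ ⋯ ⊗ T Vₙ ⟶ T (V₁ ⊗ ⋯ ⊗ Vₙ) ⟶ T W ⟶ W` equals
`T V₁ ⊗ ⋯ ⊗ T Vₙ ⟶ V₁ ⊗ ⋯ ⊗ Vₙ ⟶ W`. -/
def IsMultilinear (L : List T.Algebra) (W : T.Algebra)
    (f : tens M Monad.Algebra.A L ⟶ W.A) : Prop :=
  φ.iter Monad.Algebra.A L ≫ T.map f ≫ W.a =
    tensMap M (F := fun V : T.Algebra => T.obj V.A) (G := Monad.Algebra.A) Monad.Algebra.a L ≫ f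

/-- A multilinear map is universal if every multilinear map with the same domain factors through it
by a unique morphism of algebras. -/
def IsUniversal (L : List T.Algebra) (U : T.Algebra)
    (f : tens M Monad.Algebra.A L ⟶ U.A) : Prop :=
  φ.IsMultilinear L U f ∧
    ∀ (W : T.Algebra) (g : tens M Monad.Algebra.A L ⟶ W.A), φ.IsMultilinear L W g →
      ∃! h : U ⟶ W, f ≫ h.f = g

/-- Every finite sequence of algebras admits a universal multilinear map. -/
def UniversalMapsExist : Prop :=
  ∀ L : List T.Algebra, ∃ (U : T.Algebra) (f : tens M Monad.Algebra.A L ⟶ U.A), φ.IsUniversal L U f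

end MonoidalMonad

/-- A finite sequence of algebras, an algebra, and a map in `C` from the tensor product of the
former to the latter. -/
structure MultiMap (M : MonoidalCategory C) (T : Monad C) where
  dom : List T.Algebra
  cod : T.Algebra
  map : tens M Monad.Algebra.A dom ⟶ cod.A

/-- The tensor product `a₁ ⊗ ⋯ ⊗ aₙ` of the maps `aᵢ : Vᵢ₁ ⊗ ⋯ ⊗ Vᵢₘ ⟶ Vᵢ`, from the tensor product
of the concatenation of the domains to `V₁ ⊗ ⋯ ⊗ Vₙ`. -/
def MultiMap.tensor {M : MonoidalCategory C} {T : Monad C} : (a : List (MultiMap M T)) →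
    (tens M Monad.Algebra.A (a.flatMap MultiMap.dom) ⟶ tens M Monad.Algebra.A (a.map MultiMap.cod))
  | [] => 𝟙 (𝟙_ C)
  | a :: as => tensAppend M Monad.Algebra.A a.dom (as.flatMap MultiMap.dom) ≫
      (a.map ⊗ₘ MultiMap.tensor as) ≫
        (tensCons M Monad.Algebra.A a.cod (as.map MultiMap.cod)).inv

/-- Universal multilinear maps are closed under composition: if `b` and `a₁, …, aₙ` are universal
and composable, then `b ∘ (a₁ ⊗ ⋯ ⊗ aₙ)` is universal. -/
def MonoidalMonad.UniversalMapsCompose {M : MonoidalCategory C} {T : Monad C}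
    (φ : MonoidalMonad M T) : Prop :=
  ∀ (a : List (MultiMap M T)) (W : T.Algebra)
    (b : tens M Monad.Algebra.A (a.map MultiMap.cod) ⟶ W.A),
    (∀ m ∈ a, φ.IsUniversal m.dom m.cod m.map) → φ.IsUniversal (a.map MultiMap.cod) W b →
      φ.IsUniversal (a.flatMap MultiMap.dom) W (MultiMap.tensor a ≫ b)

end SingleStructure

/-! ### Monoidal structures with prescribed tensor products of objects and prescribed unit -/

section Prescribed

variable {A : Type u} [Category.{v} A]

/-- Functoriality data, associator and unitors on a given assignment `t` of tensor products and a
given unit object `e`. -/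
structure MonoidalData (t : A → A → A) (e : A) where
  whiskerLeft (X : A) {Y Y' : A} (f : Y ⟶ Y') : t X Y ⟶ t X Y'
  whiskerRight {X X' : A} (f : X ⟶ X') (Y : A) : t X Y ⟶ t X' Y
  associator (X Y Z : A) : t (t X Y) Z ≅ t X (t Y Z)
  leftUnitor (X : A) : t e X ≅ X
  rightUnitor (X : A) : t X e ≅ X

/-- The same data, in Mathlib's form. -/
@[reducible]
def MonoidalData.toStruct {t : A → A → A} {e : A} (M : MonoidalData t e) :
    MonoidalCategoryStruct A where
  tensorObj := t
  tensorUnit := e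
  whiskerLeft X _ _ f := M.whiskerLeft X f
  whiskerRight f Y := M.whiskerRight f Y
  associator := M.associator
  leftUnitor := M.leftUnitor
  rightUnitor := M.rightUnitor

/-- A monoidal structure with tensor products of objects `t` and unit object `e`: data as above
that satisfy the axioms of a monoidal category. -/
structure MonoidalOn (t : A → A → A) (e : A) extends MonoidalData t e where
  isMonoidal : ∃ M : MonoidalCategory A, M.toMonoidalCategoryStruct = toMonoidalData.toStruct

/-- The monoidal category given by a monoidal structure with prescribed objects. -/
@[reducible]
def MonoidalOn.toMonoidalCategory {t : A → A → A} {e : A} (M : MonoidalOn t e) :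
    MonoidalCategory A where
  toMonoidalCategoryStruct := M.toStruct
  tensorHom_def := by obtain ⟨N, h⟩ := M.isMonoidal; rw [← h]; exact N.tensorHom_def
  id_tensorHom_id := by obtain ⟨N, h⟩ := M.isMonoidal; rw [← h]; exact N.id_tensorHom_id
  tensorHom_comp_tensorHom := by
    obtain ⟨N, h⟩ := M.isMonoidal; rw [← h]; exact N.tensorHom_comp_tensorHom
  whiskerLeft_id := by obtain ⟨N, h⟩ := M.isMonoidal; rw [← h]; exact N.whiskerLeft_id
  id_whiskerRight := by obtain ⟨N, h⟩ := M.isMonoidal; rw [← h]; exact N.id_whiskerRight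
  associator_naturality := by
    obtain ⟨N, h⟩ := M.isMonoidal; rw [← h]; exact N.associator_naturality
  leftUnitor_naturality := by
    obtain ⟨N, h⟩ := M.isMonoidal; rw [← h]; exact N.leftUnitor_naturality
  rightUnitor_naturality := by
    obtain ⟨N, h⟩ := M.isMonoidal; rw [← h]; exact N.rightUnitor_naturality
  pentagon := by obtain ⟨N, h⟩ := M.isMonoidal; rw [← h]; exact N.pentagon
  triangle := by obtain ⟨N, h⟩ := M.isMonoidal; rw [← h]; exact N.triangle

end Prescribed

/-! ### Duoidal categories -/

section Duoidal

variable {C : Type u} [Category.{v} C]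

/-- A duoidal (2-monoidal) structure relating two monoidal structures `D = (⋄, I)` and
`S = (⋆, J)` on the same category: a natural interchange law `ζ`, and unit maps
`δ : I ⟶ I ⋆ I`, `θ : J ⋄ J ⟶ J` and `ζ₀ : I ⟶ J`, such that the interchange law is associative and
unital in both directions, `(J, θ, ζ₀)` is a monoid for `⋄` and `(I, δ, ζ₀)` is a comonoid
for `⋆`. -/
structure DuoidalStructure (D S : MonoidalCategory C) where
  ζ (X Y Z W : C) :
    D.tensorObj (S.tensorObj X Y) (S.tensorObj Z W) ⟶
      S.tensorObj (D.tensorObj X Z) (D.tensorObj Y W)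
  δ : D.tensorUnit ⟶ S.tensorObj D.tensorUnit D.tensorUnit
  θ : D.tensorObj S.tensorUnit S.tensorUnit ⟶ S.tensorUnit
  ζ₀ : D.tensorUnit ⟶ S.tensorUnit
  ζ_natural : ∀ {X X' Y Y' Z Z' W W' : C} (f : X ⟶ X') (g : Y ⟶ Y') (h : Z ⟶ Z') (k : W ⟶ W'),
    D.tensorHom (S.tensorHom f g) (S.tensorHom h k) ≫ ζ X' Y' Z' W' =
      ζ X Y Z W ≫ S.tensorHom (D.tensorHom f h) (D.tensorHom g k)
  /-- the two maps `(X₁ ⋆ Y₁) ⋄ (X₂ ⋆ Y₂) ⋄ (X₃ ⋆ Y₃) ⟶ (X₁ ⋄ X₂ ⋄ X₃) ⋆ (Y₁ ⋄ Y₂ ⋄ Y₃)` agree -/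
  ζ_assoc_left : ∀ X₁ Y₁ X₂ Y₂ X₃ Y₃ : C,
    D.whiskerRight (ζ X₁ Y₁ X₂ Y₂) (S.tensorObj X₃ Y₃) ≫
        ζ (D.tensorObj X₁ X₂) (D.tensorObj Y₁ Y₂) X₃ Y₃ ≫
          S.tensorHom (D.associator X₁ X₂ X₃).hom (D.associator Y₁ Y₂ Y₃).hom =
      (D.associator (S.tensorObj X₁ Y₁) (S.tensorObj X₂ Y₂) (S.tensorObj X₃ Y₃)).hom ≫
        D.whiskerLeft (S.tensorObj X₁ Y₁) (ζ X₂ Y₂ X₃ Y₃) ≫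
          ζ X₁ Y₁ (D.tensorObj X₂ X₃) (D.tensorObj Y₂ Y₃)
  /-- the two maps `(X₁ ⋆ X₂ ⋆ X₃) ⋄ (Y₁ ⋆ Y₂ ⋆ Y₃) ⟶ (X₁ ⋄ Y₁) ⋆ (X₂ ⋄ Y₂) ⋆ (X₃ ⋄ Y₃)` agree -/
  ζ_assoc_right : ∀ X₁ X₂ X₃ Y₁ Y₂ Y₃ : C,
    ζ (S.tensorObj X₁ X₂) X₃ (S.tensorObj Y₁ Y₂) Y₃ ≫
        S.whiskerRight (ζ X₁ X₂ Y₁ Y₂) (D.tensorObj X₃ Y₃) ≫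
          (S.associator (D.tensorObj X₁ Y₁) (D.tensorObj X₂ Y₂) (D.tensorObj X₃ Y₃)).hom =
      D.tensorHom (S.associator X₁ X₂ X₃).hom (S.associator Y₁ Y₂ Y₃).hom ≫
        ζ X₁ (S.tensorObj X₂ X₃) Y₁ (S.tensorObj Y₂ Y₃) ≫
          S.whiskerLeft (D.tensorObj X₁ Y₁) (ζ X₂ X₃ Y₂ Y₃)
  /-- `I ⋄ (X ⋆ Y) ⟶ (I ⋆ I) ⋄ (X ⋆ Y) ⟶ (I ⋄ X) ⋆ (I ⋄ Y) ⟶ X ⋆ Y` is the unitor -/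
  δ_left : ∀ X Y : C,
    D.whiskerRight δ (S.tensorObj X Y) ≫ ζ D.tensorUnit D.tensorUnit X Y ≫
        S.tensorHom (D.leftUnitor X).hom (D.leftUnitor Y).hom =
      (D.leftUnitor (S.tensorObj X Y)).hom
  δ_right : ∀ X Y : C,
    D.whiskerLeft (S.tensorObj X Y) δ ≫ ζ X Y D.tensorUnit D.tensorUnit ≫
        S.tensorHom (D.rightUnitor X).hom (D.rightUnitor Y).hom =
      (D.rightUnitor (S.tensorObj X Y)).hom
  /-- `(J ⋆ X) ⋄ (J ⋆ Y) ⟶ (J ⋄ J) ⋆ (X ⋄ Y) ⟶ J ⋆ (X ⋄ Y) ⟶ X ⋄ Y` is given by unitors -/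
  θ_left : ∀ X Y : C,
    ζ S.tensorUnit X S.tensorUnit Y ≫ S.whiskerRight θ (D.tensorObj X Y) ≫
        (S.leftUnitor (D.tensorObj X Y)).hom =
      D.tensorHom (S.leftUnitor X).hom (S.leftUnitor Y).hom
  θ_right : ∀ X Y : C,
    ζ X S.tensorUnit Y S.tensorUnit ≫ S.whiskerLeft (D.tensorObj X Y) θ ≫
        (S.rightUnitor (D.tensorObj X Y)).hom =
      D.tensorHom (S.rightUnitor X).hom (S.rightUnitor Y).hom
  /-- `(J, θ, ζ₀)` is a monoid in `(C, ⋄, I)` -/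
  monoid_assoc : D.whiskerRight θ S.tensorUnit ≫ θ =
    (D.associator S.tensorUnit S.tensorUnit S.tensorUnit).hom ≫
      D.whiskerLeft S.tensorUnit θ ≫ θ
  monoid_one_mul : D.whiskerRight ζ₀ S.tensorUnit ≫ θ = (D.leftUnitor S.tensorUnit).hom
  monoid_mul_one : D.whiskerLeft S.tensorUnit ζ₀ ≫ θ = (D.rightUnitor S.tensorUnit).hom
  /-- `(I, δ, ζ₀)` is a comonoid in `(C, ⋆, J)` -/
  comonoid_coassoc : δ ≫ S.whiskerRight δ D.tensorUnit ≫
      (S.associator D.tensorUnit D.tensorUnit D.tensorUnit).hom =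
    δ ≫ S.whiskerLeft D.tensorUnit δ
  comonoid_counit_left : δ ≫ S.whiskerRight ζ₀ D.tensorUnit ≫
    (S.leftUnitor D.tensorUnit).hom = 𝟙 D.tensorUnit
  comonoid_counit_right : δ ≫ S.whiskerLeft D.tensorUnit ζ₀ ≫
    (S.rightUnitor D.tensorUnit).hom = 𝟙 D.tensorUnit

/-- A bimonoidal monad on a duoidal category `(C, ⋄, ⋆)`: a monad that is monoidal for `⋄` and
comonoidal for `⋆`, such that the two structures are compatible with the interchange law and with
the unit maps. -/
structure BimonoidalMonad {D S : MonoidalCategory C} (Z : DuoidalStructure D S) (T : Monad C) where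
  φ : MonoidalMonad D T
  ψ : ComonoidalMonad S T
  interchange : ∀ X Y V W : C,
    φ.map (S.tensorObj X Y) (S.tensorObj V W) ≫ T.map (Z.ζ X Y V W) ≫
        ψ.map (D.tensorObj X V) (D.tensorObj Y W) =
      D.tensorHom (ψ.map X Y) (ψ.map V W) ≫ Z.ζ (T.obj X) (T.obj Y) (T.obj V) (T.obj W) ≫
        S.tensorHom (φ.map X V) (φ.map Y W)
  unit_δ : φ.φ₀ ≫ T.map Z.δ ≫ ψ.map D.tensorUnit D.tensorUnit = Z.δ ≫ S.tensorHom φ.φ₀ φ.φ₀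
  unit_θ : φ.map S.tensorUnit S.tensorUnit ≫ T.map Z.θ ≫ ψ.ψ₀ = D.tensorHom ψ.ψ₀ ψ.ψ₀ ≫ Z.θ
  unit_ζ₀ : φ.φ₀ ≫ T.map Z.ζ₀ ≫ ψ.ψ₀ = Z.ζ₀

end Duoidal

/-- The monoidal structure `M` on algebras, with tensor products `P V W` and unit the free algebra
on `I`, is the one induced by the bilinear maps `u V W : V ⊗ W ⟶ P V W` and by
the unit `I ⟶ T I` of the monad: tensor products of morphisms, the associator and the unitors of
`M` are compatible through these maps with those of `C`. -/
structure IsInduced {C : Type u} [Category.{v} C] (D : MonoidalCategory C) {T : Monad C}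
    {P : T.Algebra → T.Algebra → T.Algebra}
    (u : ∀ V W : T.Algebra, D.tensorObj V.A W.A ⟶ (P V W).A)
    (M : MonoidalOn P (T.free.obj D.tensorUnit)) : Prop where
  whiskerLeft : ∀ (V : T.Algebra) {W W' : T.Algebra} (f : W ⟶ W'),
    u V W ≫ (M.whiskerLeft V f).f = D.whiskerLeft V.A f.f ≫ u V W'
  whiskerRight : ∀ {V V' : T.Algebra} (f : V ⟶ V') (W : T.Algebra),
    u V W ≫ (M.whiskerRight f W).f = D.whiskerRight f.f W.A ≫ u V' W
  associator : ∀ U V W : T.Algebra,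
    D.whiskerRight (u U V) W.A ≫ u (P U V) W ≫ (M.associator U V W).hom.f =
      (D.associator U.A V.A W.A).hom ≫ D.whiskerLeft U.A (u V W) ≫ u U (P V W)
  leftUnitor : ∀ V : T.Algebra,
    D.whiskerRight (T.η.app D.tensorUnit) V.A ≫ u (T.free.obj D.tensorUnit) V ≫
      (M.leftUnitor V).hom.f = (D.leftUnitor V.A).hom
  rightUnitor : ∀ V : T.Algebra,
    D.whiskerLeft V.A (T.η.app D.tensorUnit) ≫ u V (T.free.obj D.tensorUnit) ≫
      (M.rightUnitor V).hom.f = (D.rightUnitor V.A).hom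

end DuoidalAlgebras

open DuoidalAlgebras

/-! A universal multilinear map is epic for testing algebra morphisms (`AlgEpi`): two morphisms out
of its target are equal once their composites with it agree in `C`. All the structure on algebras is
therefore obtained by descending a multilinear map, and every axiom is proved by precomposing with a
universal map and reducing to the same axiom in `C`.

For `⋄`, closure of universal maps under composition makes both iterated tensor products of three
algebras targets of universal maps out of one and the same sequence. They are thus canonically
isomorphic, which gives the associator (`IsCompatible.exists_data`). Since `η` is monoidal, `φ₀ =
η_I`, so `η_I : I ⟶ T I` is a universal nullary map (`isUniversal_unit`). Inserting it into one slot
of `u` yields a universal unary map, and comparing that with the identity gives the unitors. The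
axioms follow in `IsCompatible.isMonoidal`.

For the interchange law, compatibility of `φ`, `ψ` and `ζ` says precisely what is needed for `(f ⋆
g) ∘ ζ` to be bilinear whenever `f` and `g` are (`isMultilinear_ζ`); likewise the axiom on `θ` is
the bilinearity of `θ`. Both descend along `u`. The maps out of `T I` are determined by their
composites with `η_I`. The monoidal structure `⋆` on algebras has the constraints of `C` as
underlying maps, so each duoidal axiom becomes the one for `ζ`, `δ`, `θ`, `ζ₀` (`exists_duoidal`).
-/

namespace DuoidalAlgebras

/-! ### Multilinear maps and their universal property -/

section Multilinear

open MonoidalCategory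

variable {C : Type u} [Category.{v} C]

/-- Morphisms of algebras out of `U` are determined by their composites with `f`. -/
def AlgEpi {T : Monad C} {A : C} {U : T.Algebra} (f : A ⟶ U.A) : Prop :=
  ∀ ⦃W : T.Algebra⦄ ⦃g h : U ⟶ W⦄, f ≫ g.f = f ≫ h.f → g = h

/-- Removes the associators and unitors that precede the universal maps produced by composition. -/
theorem AlgEpi.of_comp {T : Monad C} {A B : C} {U : T.Algebra} {e : B ⟶ A} {f : A ⟶ U.A}
    (h : AlgEpi (e ≫ f)) : AlgEpi f := fun W g k hgk =>
  h (by rw [Category.assoc, Category.assoc, hgk])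

theorem algEpi_unit {T : Monad C} (X : C) : AlgEpi (U := T.free.obj X) (T.η.app X) := by
  have key : ∀ {W : T.Algebra} (g : T.obj X ⟶ W.A), T.map g ≫ W.a = T.μ.app X ≫ g →
      g = T.map (T.η.app X ≫ g) ≫ W.a := by
    intro W g h
    -- The rest is the monad law `T.map η ≫ μ = 𝟙`.
    rw [T.map_comp, Category.assoc, h]
    exact (Category.id_comp g).symm.trans
      ((congrArg (· ≫ g) (T.right_unit X).symm).trans (Category.assoc _ _ _))
  intro W g h hgh
  exact Monad.Algebra.Hom.ext
    ((key g.f g.h).trans ((congrArg (T.map · ≫ W.a) hgh).trans (key h.f h.h).symm))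

namespace MonoidalMonad

variable {M : MonoidalCategory C} {T : Monad C} (φ : MonoidalMonad M T)

/-- This is the unit condition for `η` to be a morphism of monoidal functors. It turns the nullary
multilinearity condition into the unit law of the target algebra. -/
theorem φ₀_eq : φ.φ₀ = T.η.app (𝟙_ C) := by
  let _ := φ.lax
  have h := φ.unit_isMonoidal
  have := h.unit
  exact (this.symm.trans (Category.id_comp _))

variable {φ}

theorem isMultilinear_pair {V W Q : T.Algebra} {f : V.A ⊗ W.A ⟶ Q.A} :
    φ.IsMultilinear [V, W] Q f ↔ φ.map V.A W.A ≫ T.map f ≫ Q.a = (V.a ⊗ₘ W.a) ≫ f := by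
  change (T.obj V.A ◁ 𝟙 (T.obj W.A) ≫ φ.map V.A W.A) ≫ T.map f ≫ Q.a = (V.a ⊗ₘ W.a) ≫ f ↔ _
  rw [whiskerLeft_id, Category.id_comp]

theorem isMultilinear_singleton {V Q : T.Algebra} {f : V.A ⟶ Q.A} :
    φ.IsMultilinear [V] Q f ↔ T.map f ≫ Q.a = V.a ≫ f := by
  change 𝟙 (T.obj V.A) ≫ T.map f ≫ Q.a = V.a ≫ f ↔ _
  rw [Category.id_comp]

theorem IsMultilinear.comp {L : List T.Algebra} {Q R : T.Algebra}
    {f : tens M Monad.Algebra.A L ⟶ Q.A} (hf : φ.IsMultilinear L Q f) (h : Q ⟶ R) :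
    φ.IsMultilinear L R (f ≫ h.f) := by
  unfold IsMultilinear at *
  rw [T.map_comp, Category.assoc, h.h, ← Category.assoc (tensMap _ _ _), ← hf]
  simp only [Category.assoc]

theorem map_natural {X X' Y Y' : C} (f : X ⟶ X') (g : Y ⟶ Y') :
    (T.map f ⊗ₘ T.map g) ≫ φ.map X' Y' = φ.map X Y ≫ T.map (f ⊗ₘ g) :=
  let _ := φ.lax
  Functor.LaxMonoidal.μ_natural T.toFunctor f g

/-- Naturality of `φ` carries the actions past the morphisms. This is what lets tensor products of
algebra morphisms descend along `u`. -/
theorem IsMultilinear.tensorHom_comp {V V' W W' Q : T.Algebra} {k : V'.A ⊗ W'.A ⟶ Q.A}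
    (hk : φ.IsMultilinear [V', W'] Q k) (f : V ⟶ V') (g : W ⟶ W') :
    φ.IsMultilinear [V, W] Q ((f.f ⊗ₘ g.f : V.A ⊗ W.A ⟶ V'.A ⊗ W'.A) ≫ k) := by
  have hk' := isMultilinear_pair.1 hk
  have key : φ.map V.A W.A ≫ T.map ((f.f ⊗ₘ g.f) ≫ k) ≫ Q.a = (V.a ⊗ₘ W.a) ≫ (f.f ⊗ₘ g.f) ≫ k := by
    rw [T.map_comp, Category.assoc, ← Category.assoc (φ.map _ _), ← map_natural, Category.assoc,
      hk', tensorHom_comp_tensorHom_assoc, tensorHom_comp_tensorHom_assoc, f.h, g.h]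
  exact isMultilinear_pair.2 key

section Universal

variable {L : List T.Algebra} {U : T.Algebra} {f : tens M Monad.Algebra.A L ⟶ U.A}

theorem IsUniversal.algEpi (hf : φ.IsUniversal L U f) : AlgEpi f := fun W _ h hgh =>
  (hf.2 W (f ≫ h.f) (hf.1.comp h)).unique hgh rfl

/-- The morphism of algebras that a multilinear map induces on the target of a universal one. -/
noncomputable def IsUniversal.desc (hf : φ.IsUniversal L U f) {W : T.Algebra}
    {g : tens M Monad.Algebra.A L ⟶ W.A} (hg : φ.IsMultilinear L W g) : U ⟶ W :=
  (hf.2 W g hg).choose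

theorem IsUniversal.fac (hf : φ.IsUniversal L U f) {W : T.Algebra}
    {g : tens M Monad.Algebra.A L ⟶ W.A} (hg : φ.IsMultilinear L W g) :
    f ≫ (hf.desc hg).f = g :=
  (hf.2 W g hg).choose_spec.1

/-- Two universal multilinear maps with the same domain have isomorphic targets. -/
noncomputable def IsUniversal.iso (hf : φ.IsUniversal L U f) {W : T.Algebra}
    {g : tens M Monad.Algebra.A L ⟶ W.A} (hg : φ.IsUniversal L W g) : U ≅ W where
  hom := hf.desc hg.1
  inv := hg.desc hf.1
  hom_inv_id := hf.algEpi (by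
    rw [Monad.Algebra.comp_f, ← Category.assoc, hf.fac, hg.fac, Monad.Algebra.id_f,
      Category.comp_id])
  inv_hom_id := hg.algEpi (by
    rw [Monad.Algebra.comp_f, ← Category.assoc, hg.fac, hf.fac, Monad.Algebra.id_f,
      Category.comp_id])

theorem IsUniversal.iso_fac (hf : φ.IsUniversal L U f) {W : T.Algebra}
    {g : tens M Monad.Algebra.A L ⟶ W.A} (hg : φ.IsUniversal L W g) :
    f ≫ (hf.iso hg).hom.f = g :=
  hf.fac hg.1

end Universal

variable (φ) in
-- A unary multilinear map is the same thing as an algebra morphism. The identity fills the idle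
-- slots when universal maps are composed.
theorem isUniversal_id (V : T.Algebra) : φ.IsUniversal [V] V (𝟙 V.A) := by
  refine ⟨isMultilinear_singleton.2 (by simp), fun W g hg => ?_⟩
  refine ⟨⟨g, isMultilinear_singleton.1 hg⟩, Category.id_comp _, fun h hh => ?_⟩
  exact Monad.Algebra.Hom.ext ((Category.id_comp _).symm.trans hh)

theorem unit_map_act {W : T.Algebra} {X : C} (g : X ⟶ W.A) : T.η.app X ≫ T.map g ≫ W.a = g := by
  have h : T.η.app X ≫ T.map g = g ≫ T.η.app W.A := (T.η.naturality g).symm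
  rw [← Category.assoc, h, Category.assoc, W.unit, Category.comp_id]

/-- The morphism of algebras out of a free algebra that a map in `C` determines. -/
def unitDesc {W : T.Algebra} {X : C} (g : X ⟶ W.A) : T.free.obj X ⟶ W where
  f := (T.map g ≫ W.a : T.obj X ⟶ W.A)
  h := by
    have h : T.μ.app X ≫ T.map g = T.map (T.map g) ≫ T.μ.app W.A := (T.μ.naturality g).symm
    change T.map (T.map g ≫ W.a) ≫ W.a = T.μ.app X ≫ T.map g ≫ W.a
    rw [T.map_comp, Category.assoc, ← W.assoc, ← Category.assoc, ← h, Category.assoc]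

theorem unit_unitDesc {W : T.Algebra} {X : C} (g : X ⟶ W.A) :
    T.η.app X ≫ (unitDesc g).f = g :=
  unit_map_act g

variable (φ) in
-- Every map `I ⟶ W` in `C` is nullary multilinear because `φ₀ = η_I`, so the claim is the universal
-- property of the free algebra.
theorem isUniversal_unit : φ.IsUniversal [] (T.free.obj (𝟙_ C)) (T.η.app (𝟙_ C)) := by
  refine ⟨?_, fun W g _ => ?_⟩
  · change φ.φ₀ ≫ T.map (T.η.app (𝟙_ C)) ≫ T.μ.app (𝟙_ C) = 𝟙 (𝟙_ C) ≫ T.η.app (𝟙_ C)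
    rw [φ₀_eq, Category.id_comp]
    exact unit_map_act (W := T.free.obj (𝟙_ C)) _
  · exact ⟨unitDesc g, unit_unitDesc g, fun h hh =>
      algEpi_unit _ (hh.trans (unit_unitDesc g).symm)⟩

/-! ### Composing universal maps in low arity -/

section Compose

/-- Here and in the next two lemmas the rebracketing map is a variable, so that the recursively
defined `MultiMap.tensor` matches the left side by unfolding. -/
theorem comp_tensorHom_id_unitor {A X : C} {t : A ⟶ A ⊗ 𝟙_ C} (ht : t = (ρ_ A).inv) (f : A ⟶ X) :
    t ≫ (f ⊗ₘ 𝟙 (𝟙_ C)) ≫ (ρ_ X).hom = f := by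
  simp [ht]

theorem comp_tensorHom_id {A B X Y : C} (t : A ⟶ B ⊗ Y) (f : B ⟶ X) {g : Y ⟶ Y} (hg : g = 𝟙 Y) :
    t ≫ (f ⊗ₘ g) ≫ 𝟙 (X ⊗ Y) = t ≫ f ▷ Y := by
  simp [hg]

theorem comp_id_tensorHom {A X Y Z : C} {t t' : A ⟶ X ⊗ Y} (ht : t = t') {f f' : Y ⟶ Z}
    (hf : f = f') : t ≫ (𝟙 X ⊗ₘ f) ≫ 𝟙 (X ⊗ Z) = t' ≫ X ◁ f' := by
  simp [ht, hf]

theorem tensAppend_singleton_nil (V : T.Algebra) :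
    tensAppend M Monad.Algebra.A [V] [] = (ρ_ V.A).inv := by
  change (ρ_ V.A).inv ≫ V.A ◁ (λ_ (𝟙_ C)).inv ≫ (α_ _ _ _).inv ≫ (ρ_ V.A).hom ▷ (𝟙_ C) = _
  simp

theorem tensAppend_pair_nil (V W : T.Algebra) :
    tensAppend M Monad.Algebra.A [V, W] [] = (ρ_ (V.A ⊗ W.A)).inv := by
  change 𝟙 _ ≫ V.A ◁ tensAppend M Monad.Algebra.A [W] [] ≫ (α_ _ _ _).inv ≫
    𝟙 (V.A ⊗ W.A) ▷ (𝟙_ C) = _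
  rw [tensAppend_singleton_nil]
  have key : 𝟙 (V.A ⊗ W.A) ≫ V.A ◁ (ρ_ W.A).inv ≫ (α_ V.A W.A (𝟙_ C)).inv ≫
      𝟙 (V.A ⊗ W.A) ▷ (𝟙_ C) = (ρ_ (V.A ⊗ W.A)).inv := by simp
  exact key

theorem tensor_singleton_singleton (V X : T.Algebra) (f : V.A ⟶ X.A) :
    MultiMap.tensor [(⟨[V], X, f⟩ : MultiMap M T)] = f := by
  exact comp_tensorHom_id_unitor (tensAppend_singleton_nil V) f

theorem tensor_singleton_pair (V W X : T.Algebra) (f : V.A ⊗ W.A ⟶ X.A) :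
    MultiMap.tensor [(⟨[V, W], X, f⟩ : MultiMap M T)] = f := by
  exact comp_tensorHom_id_unitor (tensAppend_pair_nil V W) f

theorem tensor_singleton_nil (X : T.Algebra) (f : 𝟙_ C ⟶ X.A) :
    MultiMap.tensor [(⟨[], X, f⟩ : MultiMap M T)] = f := by
  change (λ_ (𝟙_ C)).inv ≫ (f ⊗ₘ 𝟙 (𝟙_ C)) ≫ (ρ_ X.A).hom = f
  simp [unitors_inv_equal]

theorem UniversalMapsCompose.right (hc : φ.UniversalMapsCompose) {L : List T.Algebra}
    {X W Q : T.Algebra} {f : tens M Monad.Algebra.A L ⟶ X.A} {g : X.A ⊗ W.A ⟶ Q.A}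
    (hf : φ.IsUniversal L X f) (hg : φ.IsUniversal [X, W] Q g) :
    φ.IsUniversal (L ++ [W]) Q (tensAppend M Monad.Algebra.A L [W] ≫ f ▷ W.A ≫ g) := by
  have h := hc [⟨L, X, f⟩, ⟨[W], W, 𝟙 W.A⟩] Q g (by
    intro m hm
    simp only [List.mem_cons, List.not_mem_nil, or_false] at hm
    rcases hm with rfl | rfl
    exacts [hf, isUniversal_id φ W]) hg
  have e : MultiMap.tensor [(⟨L, X, f⟩ : MultiMap M T), ⟨[W], W, 𝟙 W.A⟩] =
      tensAppend M Monad.Algebra.A L [W] ≫ f ▷ W.A :=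
    comp_tensorHom_id _ _ (tensor_singleton_singleton W W (𝟙 W.A))
  rw [e] at h
  exact (Category.assoc (tensAppend M Monad.Algebra.A L [W]) (f ▷ W.A) g) ▸ h

theorem tensAppend_singleton_cons (V : T.Algebra) (W : T.Algebra) (K : List T.Algebra) :
    tensAppend M Monad.Algebra.A [V] (W :: K) = 𝟙 _ := by
  change 𝟙 _ ≫ V.A ◁ (λ_ (tens M Monad.Algebra.A (W :: K))).inv ≫ (α_ _ _ _).inv ≫
    (ρ_ V.A).hom ▷ _ = _
  simp
  rfl

/-- No associator appears, since tensor products of sequences are already bracketed to the right. -/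
theorem UniversalMapsCompose.left (hc : φ.UniversalMapsCompose) {V W K X Q : T.Algebra}
    {f : W.A ⊗ K.A ⟶ X.A} {g : V.A ⊗ X.A ⟶ Q.A}
    (hf : φ.IsUniversal [W, K] X f) (hg : φ.IsUniversal [V, X] Q g) :
    φ.IsUniversal [V, W, K] Q (V.A ◁ f ≫ g) := by
  have h := hc [⟨[V], V, 𝟙 V.A⟩, ⟨[W, K], X, f⟩] Q g (by
    intro m hm
    simp only [List.mem_cons, List.not_mem_nil, or_false] at hm
    rcases hm with rfl | rfl
    exacts [isUniversal_id φ V, hf]) hg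
  have e : MultiMap.tensor [(⟨[V], V, 𝟙 V.A⟩ : MultiMap M T), ⟨[W, K], X, f⟩] = V.A ◁ f :=
    (comp_id_tensorHom (tensAppend_singleton_cons V W [K])
      (tensor_singleton_pair W K X f)).trans (Category.id_comp _)
  rw [e] at h
  exact h

theorem UniversalMapsCompose.left_nil (hc : φ.UniversalMapsCompose) {V X Q : T.Algebra}
    {f : 𝟙_ C ⟶ X.A} {g : V.A ⊗ X.A ⟶ Q.A}
    (hf : φ.IsUniversal [] X f) (hg : φ.IsUniversal [V, X] Q g) :
    φ.IsUniversal [V] Q ((ρ_ V.A).inv ≫ V.A ◁ f ≫ g) := by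
  have h := hc [⟨[V], V, 𝟙 V.A⟩, ⟨[], X, f⟩] Q g (by
    intro m hm
    simp only [List.mem_cons, List.not_mem_nil, or_false] at hm
    rcases hm with rfl | rfl
    exacts [isUniversal_id φ V, hf]) hg
  have e : MultiMap.tensor [(⟨[V], V, 𝟙 V.A⟩ : MultiMap M T), ⟨[], X, f⟩] =
      (ρ_ V.A).inv ≫ V.A ◁ f :=
    comp_id_tensorHom (tensAppend_singleton_nil V) (tensor_singleton_nil X f)
  rw [e] at h
  exact (Category.assoc (ρ_ V.A).inv (V.A ◁ f) g) ▸ h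

theorem UniversalMapsCompose.right_nil (hc : φ.UniversalMapsCompose) {X W Q : T.Algebra}
    {f : 𝟙_ C ⟶ X.A} {g : X.A ⊗ W.A ⟶ Q.A}
    (hf : φ.IsUniversal [] X f) (hg : φ.IsUniversal [X, W] Q g) :
    φ.IsUniversal [W] Q ((λ_ W.A).inv ≫ f ▷ W.A ≫ g) :=
  hc.right hf hg

theorem tensAppend_pair_singleton (U V W : T.Algebra) :
    tensAppend M Monad.Algebra.A [U, V] [W] = (α_ U.A V.A W.A).inv := by
  change 𝟙 _ ≫ U.A ◁ tensAppend M Monad.Algebra.A [V] [W] ≫ (α_ _ _ _).inv ≫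
    𝟙 (U.A ⊗ V.A) ▷ W.A = _
  rw [tensAppend_singleton_cons]
  exact (Category.id_comp _).trans ((congrArg₂ (· ≫ ·) (whiskerLeft_id _ _)
    ((congrArg (_ ≫ ·) (id_whiskerRight _ _)).trans (Category.comp_id _))).trans
      (Category.id_comp _))

theorem UniversalMapsCompose.right_pair (hc : φ.UniversalMapsCompose) {U V X W Q : T.Algebra}
    {f : U.A ⊗ V.A ⟶ X.A} {g : X.A ⊗ W.A ⟶ Q.A}
    (hf : φ.IsUniversal [U, V] X f) (hg : φ.IsUniversal [X, W] Q g) :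
    φ.IsUniversal [U, V, W] Q ((α_ U.A V.A W.A).inv ≫ f ▷ W.A ≫ g) := by
  have h := hc.right hf hg
  rw [tensAppend_pair_singleton] at h
  exact h

/-- `AlgEpi` tests only algebra morphisms, so it does not pass through whiskering formally; closure
under composition supplies this. -/
theorem UniversalMapsCompose.algEpi (hc : φ.UniversalMapsCompose) {L : List T.Algebra}
    {X W Q : T.Algebra} {f : tens M Monad.Algebra.A L ⟶ X.A} {g : X.A ⊗ W.A ⟶ Q.A}
    (hf : φ.IsUniversal L X f) (hg : φ.IsUniversal [X, W] Q g) : AlgEpi (f ▷ W.A ≫ g) :=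
  (hc.right hf hg).algEpi.of_comp

end Compose

end MonoidalMonad

end Multilinear

/-- The tensor product of two morphisms. -/
def MonoidalData.tensorHom {A : Type u} [Category.{v} A] {t : A → A → A} {e : A}
    (N : MonoidalData t e) {X X' Y Y' : A} (f : X ⟶ X') (g : Y ⟶ Y') : t X Y ⟶ t X' Y' :=
  N.whiskerRight f Y ≫ N.whiskerLeft X' g

/-! ### The monoidal structure induced on algebras by universal bilinear maps -/

section Induced

open MonoidalCategory

variable {C : Type u} [Category.{v} C] {M : MonoidalCategory C} {T : Monad C}

/-- Functoriality data, associator and unitors on algebras that are compatible with those of `C`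
through bilinear maps `u V W : V ⊗ W ⟶ P V W` and a map `e : 𝟙_ C ⟶ E`. -/
structure IsCompatible {P : T.Algebra → T.Algebra → T.Algebra} {E : T.Algebra}
    (u : ∀ V W : T.Algebra, V.A ⊗ W.A ⟶ (P V W).A) (e : 𝟙_ C ⟶ E.A)
    (N : MonoidalData P E) : Prop where
  whiskerLeft : ∀ (V : T.Algebra) {W W' : T.Algebra} (f : W ⟶ W'),
    u V W ≫ (N.whiskerLeft V f).f = V.A ◁ f.f ≫ u V W'
  whiskerRight : ∀ {V V' : T.Algebra} (f : V ⟶ V') (W : T.Algebra),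
    u V W ≫ (N.whiskerRight f W).f = f.f ▷ W.A ≫ u V' W
  associator : ∀ U V W : T.Algebra,
    u U V ▷ W.A ≫ u (P U V) W ≫ (N.associator U V W).hom.f =
      (α_ U.A V.A W.A).hom ≫ U.A ◁ u V W ≫ u U (P V W)
  leftUnitor : ∀ V : T.Algebra, e ▷ V.A ≫ u E V ≫ (N.leftUnitor V).hom.f = (λ_ V.A).hom
  rightUnitor : ∀ V : T.Algebra, V.A ◁ e ≫ u V E ≫ (N.rightUnitor V).hom.f = (ρ_ V.A).hom

namespace IsCompatible

variable {φ : MonoidalMonad M T} {P : T.Algebra → T.Algebra → T.Algebra} {E : T.Algebra}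
  {u : ∀ V W : T.Algebra, V.A ⊗ W.A ⟶ (P V W).A} {e : 𝟙_ C ⟶ E.A}

theorem algEpi_assoc (hc : φ.UniversalMapsCompose)
    (hu : ∀ V W : T.Algebra, φ.IsUniversal [V, W] (P V W) (u V W)) (U V W : T.Algebra) :
    AlgEpi (u U V ▷ W.A ≫ u (P U V) W) :=
  hc.algEpi (hu U V) (hu _ W)

/-- The test map for the pentagon: a universal trilinear map inserted into the left slot of a
universal bilinear one. -/
theorem algEpi_assoc₂ (hc : φ.UniversalMapsCompose)
    (hu : ∀ V W : T.Algebra, φ.IsUniversal [V, W] (P V W) (u V W)) (U V W X : T.Algebra) :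
    AlgEpi ((u U V ▷ W.A ≫ u (P U V) W) ▷ X.A ≫ u (P (P U V) W) X) := by
  have h : AlgEpi (((α_ U.A V.A W.A).inv ≫ u U V ▷ W.A ≫ u (P U V) W) ▷ X.A ≫
    u (P (P U V) W) X) := hc.algEpi (hc.right_pair (hu U V) (hu _ W)) (hu _ X)
  rw [comp_whiskerRight, Category.assoc] at h
  exact h.of_comp

theorem algEpi_left (hc : φ.UniversalMapsCompose)
    (hu : ∀ V W : T.Algebra, φ.IsUniversal [V, W] (P V W) (u V W))
    (he : φ.IsUniversal [] E e) (V : T.Algebra) : AlgEpi (e ▷ V.A ≫ u E V) :=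
  hc.algEpi he (hu E V)

theorem algEpi_right (hc : φ.UniversalMapsCompose)
    (hu : ∀ V W : T.Algebra, φ.IsUniversal [V, W] (P V W) (u V W))
    (he : φ.IsUniversal [] E e) (V : T.Algebra) : AlgEpi (V.A ◁ e ≫ u V E) :=
  (hc.left_nil he (hu V E)).algEpi.of_comp

/-- The test map for the triangle, with the unit inserted between the two algebras. -/
theorem algEpi_middle (hc : φ.UniversalMapsCompose)
    (hu : ∀ V W : T.Algebra, φ.IsUniversal [V, W] (P V W) (u V W))
    (he : φ.IsUniversal [] E e) (V W : T.Algebra) :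
    AlgEpi ((V.A ◁ e ≫ u V E) ▷ W.A ≫ u (P V E) W) := by
  have h : AlgEpi (((ρ_ V.A).inv ≫ V.A ◁ e ≫ u V E) ▷ W.A ≫ u (P V E) W) :=
    hc.algEpi (hc.left_nil he (hu V E)) (hu _ W)
  rw [comp_whiskerRight, Category.assoc] at h
  exact h.of_comp

/-- Whiskerings are descended bilinear maps. The associator and unitors compare two universal maps
out of the same sequence, of length three and one respectively. -/
theorem exists_data (hc : φ.UniversalMapsCompose)
    (hu : ∀ V W : T.Algebra, φ.IsUniversal [V, W] (P V W) (u V W))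
    (he : φ.IsUniversal [] E e) : ∃ N : MonoidalData P E, IsCompatible u e N := by
  have hl : ∀ (V : T.Algebra) {W W' : T.Algebra} (f : W ⟶ W'),
      φ.IsMultilinear [V, W] (P V W') (V.A ◁ f.f ≫ u V W') := by
    intro V W W' f
    have h := (hu V W').1.tensorHom_comp (𝟙 V) f
    rwa [Monad.Algebra.id_f, id_tensorHom] at h
  have hr : ∀ {V V' : T.Algebra} (f : V ⟶ V') (W : T.Algebra),
      φ.IsMultilinear [V, W] (P V' W) (f.f ▷ W.A ≫ u V' W) := by
    intro V V' f W
    have h := (hu V' W).1.tensorHom_comp f (𝟙 W)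
    rwa [Monad.Algebra.id_f, tensorHom_id] at h
  let N : MonoidalData P E :=
    { whiskerLeft := fun V _ _ f => (hu V _).desc (hl V f)
      whiskerRight := fun f W => (hu _ W).desc (hr f W)
      associator := fun U V W =>
        (hc.right_pair (hu U V) (hu _ W)).iso (hc.left (hu V W) (hu U _))
      leftUnitor := fun V => (hc.right_nil he (hu E V)).iso (φ.isUniversal_id V)
      rightUnitor := fun V => (hc.left_nil he (hu V E)).iso (φ.isUniversal_id V) }
  refine ⟨N, fun V _ _ f => (hu V _).fac (hl V f), fun f W => (hu _ W).fac (hr f W),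
    fun U V W => ?_, fun V => ?_, fun V => ?_⟩
  · have h : ((α_ U.A V.A W.A).inv ≫ u U V ▷ W.A ≫ u (P U V) W) ≫ (N.associator U V W).hom.f =
        U.A ◁ u V W ≫ u U (P V W) :=
      (hc.right_pair (hu U V) (hu _ W)).iso_fac (hc.left (hu V W) (hu U _))
    rw [← h]
    simp
  · have h : ((λ_ V.A).inv ≫ e ▷ V.A ≫ u E V) ≫ (N.leftUnitor V).hom.f = 𝟙 V.A :=
      (hc.right_nil he (hu E V)).iso_fac (φ.isUniversal_id V)
    simpa [Iso.inv_comp_eq] using h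
  · have h : ((ρ_ V.A).inv ≫ V.A ◁ e ≫ u V E) ≫ (N.rightUnitor V).hom.f = 𝟙 V.A :=
      (hc.left_nil he (hu V E)).iso_fac (φ.isUniversal_id V)
    simpa [Iso.inv_comp_eq] using h

variable {N : MonoidalData P E}

theorem tensorHom (hN : IsCompatible u e N) {V V' W W' : T.Algebra} (f : V ⟶ V') (g : W ⟶ W') :
    u V W ≫ (N.tensorHom f g).f = (f.f ⊗ₘ g.f) ≫ u V' W' := by
  change u V W ≫ (N.whiskerRight f W).f ≫ (N.whiskerLeft V' g).f = _
  rw [reassoc_of% (hN.whiskerRight f W), hN.whiskerLeft, MonoidalCategory.tensorHom_def,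
    Category.assoc]

theorem isMonoidal (hN : IsCompatible u e N) (hc : φ.UniversalMapsCompose)
    (hu : ∀ V W : T.Algebra, φ.IsUniversal [V, W] (P V W) (u V W))
    (he : φ.IsUniversal [] E e) :
    ∃ K : MonoidalCategory T.Algebra, K.toMonoidalCategoryStruct = N.toStruct := by
  have epi : ∀ V W, AlgEpi (u V W) := fun V W => (hu V W).algEpi
  refine ⟨{ toMonoidalCategoryStruct := N.toStruct
            -- `toStruct` leaves `tensorHom` at its default, right whiskering followed by left
            -- whiskering.
            tensorHom_def := fun _ _ => rfl
            id_tensorHom_id := ?_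
            tensorHom_comp_tensorHom := ?_
            whiskerLeft_id := ?_
            id_whiskerRight := ?_
            associator_naturality := ?_
            leftUnitor_naturality := ?_
            rightUnitor_naturality := ?_
            pentagon := ?_
            triangle := ?_ }, rfl⟩
  · intro V W
    apply epi V W
    change u V W ≫ (N.tensorHom (𝟙 V) (𝟙 W)).f = u V W ≫ 𝟙 (P V W).A
    rw [hN.tensorHom]
    simp
  · intro U V W U' V' W' f g h k
    apply epi
    change u U U' ≫ (N.tensorHom f g).f ≫ (N.tensorHom h k).f =
      u U U' ≫ (N.tensorHom (f ≫ h) (g ≫ k)).f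
    rw [reassoc_of% (hN.tensorHom f g), hN.tensorHom, hN.tensorHom]
    simp
  · intro V W
    apply epi V W
    change u V W ≫ (N.whiskerLeft V (𝟙 W)).f = u V W ≫ 𝟙 (P V W).A
    rw [hN.whiskerLeft]
    simp
  · intro V W
    apply epi V W
    change u V W ≫ (N.whiskerRight (𝟙 V) W).f = u V W ≫ 𝟙 (P V W).A
    rw [hN.whiskerRight]
    simp
  · intro X₁ X₂ X₃ Y₁ Y₂ Y₃ f g h
    apply algEpi_assoc hc hu
    change (u X₁ X₂ ▷ X₃.A ≫ u (P X₁ X₂) X₃) ≫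
      (N.tensorHom (N.tensorHom f g) h).f ≫ (N.associator Y₁ Y₂ Y₃).hom.f =
      (u X₁ X₂ ▷ X₃.A ≫ u (P X₁ X₂) X₃) ≫ (N.associator X₁ X₂ X₃).hom.f ≫
        (N.tensorHom f (N.tensorHom g h)).f
    rw [Category.assoc, Category.assoc, reassoc_of% (hN.tensorHom (N.tensorHom f g) h),
      reassoc_of% (hN.associator X₁ X₂ X₃), hN.tensorHom, whiskerRight_comp_tensorHom_assoc,
      hN.tensorHom, whiskerLeft_comp_tensorHom_assoc, hN.tensorHom]
    rw [← tensorHom_comp_whiskerRight_assoc, hN.associator, associator_naturality_assoc,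
      ← tensorHom_comp_whiskerLeft_assoc]
  · intro V W f
    apply algEpi_left hc hu he
    change (e ▷ V.A ≫ u E V) ≫ (N.whiskerLeft E f).f ≫ (N.leftUnitor W).hom.f =
      (e ▷ V.A ≫ u E V) ≫ (N.leftUnitor V).hom.f ≫ f.f
    rw [Category.assoc, Category.assoc, reassoc_of% (hN.whiskerLeft E f),
      reassoc_of% (hN.leftUnitor V), ← whisker_exchange_assoc, hN.leftUnitor,
      leftUnitor_naturality]
  · intro V W f
    apply algEpi_right hc hu he
    change (V.A ◁ e ≫ u V E) ≫ (N.whiskerRight f E).f ≫ (N.rightUnitor W).hom.f =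
      (V.A ◁ e ≫ u V E) ≫ (N.rightUnitor V).hom.f ≫ f.f
    rw [Category.assoc, Category.assoc, reassoc_of% (hN.whiskerRight f E),
      reassoc_of% (hN.rightUnitor V), whisker_exchange_assoc, hN.rightUnitor,
      rightUnitor_naturality]
  · intro W X Y Z
    apply algEpi_assoc₂ hc hu
    change ((u W X ▷ Y.A ≫ u (P W X) Y) ▷ Z.A ≫ u (P (P W X) Y) Z) ≫
      (N.whiskerRight (N.associator W X Y).hom Z).f ≫ (N.associator W (P X Y) Z).hom.f ≫
        (N.whiskerLeft W (N.associator X Y Z).hom).f =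
      ((u W X ▷ Y.A ≫ u (P W X) Y) ▷ Z.A ≫ u (P (P W X) Y) Z) ≫
        (N.associator (P W X) Y Z).hom.f ≫ (N.associator W X (P Y Z)).hom.f
    -- Each associator of algebras is traded for one of `C`, pushing the maps `u` to the right; what
    -- remains is the pentagon in `C`.
    rw [Category.assoc, Category.assoc,
      reassoc_of% (hN.whiskerRight (N.associator W X Y).hom Z), ← comp_whiskerRight_assoc,
      Category.assoc, hN.associator, comp_whiskerRight_assoc, comp_whiskerRight_assoc,
      reassoc_of% (hN.associator W (P X Y) Z), hN.whiskerLeft, comp_whiskerRight_assoc,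
      reassoc_of% (hN.associator (P W X) Y Z), associator_naturality_left_assoc,
      ← whisker_exchange_assoc, hN.associator, associator_naturality_middle_assoc,
      ← whiskerLeft_comp_assoc, ← whiskerLeft_comp_assoc, Category.assoc, hN.associator]
    simp
  · intro V W
    apply algEpi_middle hc hu he
    change ((V.A ◁ e ≫ u V E) ▷ W.A ≫ u (P V E) W) ≫ (N.associator V E W).hom.f ≫
        (N.whiskerLeft V (N.leftUnitor W).hom).f =
      ((V.A ◁ e ≫ u V E) ▷ W.A ≫ u (P V E) W) ≫ (N.whiskerRight (N.rightUnitor V).hom W).f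
    rw [Category.assoc, Category.assoc, hN.whiskerRight, ← comp_whiskerRight_assoc,
      Category.assoc, hN.rightUnitor, comp_whiskerRight_assoc,
      reassoc_of% (hN.associator V E W), hN.whiskerLeft, associator_naturality_middle_assoc,
      ← whiskerLeft_comp_assoc, ← whiskerLeft_comp_assoc, Category.assoc, hN.leftUnitor]
    simp

end IsCompatible

end Induced

/-! ### The duoidal structure on algebras -/

section Duoidal

variable {C : Type u} [Category.{v} C] {D S : MonoidalCategory C}

namespace DuoidalStructure

variable (Z : DuoidalStructure D S)

theorem ζ_natural_right {X X' Y Y' : C} (f : X ⟶ X') (g : Y ⟶ Y') (V W : C) :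
    D.whiskerRight (S.tensorHom f g) (S.tensorObj V W) ≫ Z.ζ X' Y' V W =
      Z.ζ X Y V W ≫ S.tensorHom (D.whiskerRight f V) (D.whiskerRight g W) := by
  have h := Z.ζ_natural f g (𝟙 V) (𝟙 W)
  rwa [S.id_tensorHom_id, @MonoidalCategory.tensorHom_id C _ D,
    @MonoidalCategory.tensorHom_id C _ D, @MonoidalCategory.tensorHom_id C _ D] at h

theorem ζ_natural_left (X Y : C) {V V' W W' : C} (f : V ⟶ V') (g : W ⟶ W') :
    D.whiskerLeft (S.tensorObj X Y) (S.tensorHom f g) ≫ Z.ζ X Y V' W' =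
      Z.ζ X Y V W ≫ S.tensorHom (D.whiskerLeft X f) (D.whiskerLeft Y g) := by
  have h := Z.ζ_natural (𝟙 X) (𝟙 Y) f g
  rwa [S.id_tensorHom_id, @MonoidalCategory.id_tensorHom C _ D,
    @MonoidalCategory.id_tensorHom C _ D, @MonoidalCategory.id_tensorHom C _ D] at h

end DuoidalStructure

namespace BimonoidalMonad

variable {Z : DuoidalStructure D S} {T : Monad C} (B : BimonoidalMonad Z T)

/-- Naturality of `ψ`, the interchange axiom, bilinearity of `f` and `g`, and naturality of `ζ`, in
that order, carry the actions across. -/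
theorem isMultilinear_ζ {X Y V W Q R : T.Algebra} {f : D.tensorObj X.A V.A ⟶ Q.A}
    {g : D.tensorObj Y.A W.A ⟶ R.A} (hf : B.φ.IsMultilinear [X, V] Q f)
    (hg : B.φ.IsMultilinear [Y, W] R g) :
    B.φ.IsMultilinear [B.ψ.algTensor X Y, B.ψ.algTensor V W] (B.ψ.algTensor Q R)
      (Z.ζ X.A Y.A V.A W.A ≫ S.tensorHom f g : D.tensorObj (S.tensorObj X.A Y.A)
        (S.tensorObj V.A W.A) ⟶ S.tensorObj Q.A R.A) := by
  have hf' : B.φ.map X.A V.A ≫ T.map f ≫ Q.a = D.tensorHom X.a V.a ≫ f :=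
    MonoidalMonad.isMultilinear_pair.1 hf
  have hg' : B.φ.map Y.A W.A ≫ T.map g ≫ R.a = D.tensorHom Y.a W.a ≫ g :=
    MonoidalMonad.isMultilinear_pair.1 hg
  refine MonoidalMonad.isMultilinear_pair.2 ?_
  have key : B.φ.map (S.tensorObj X.A Y.A) (S.tensorObj V.A W.A) ≫
      T.map (Z.ζ X.A Y.A V.A W.A ≫ S.tensorHom f g) ≫ B.ψ.map Q.A R.A ≫ S.tensorHom Q.a R.a =
      D.tensorHom (B.ψ.map X.A Y.A ≫ S.tensorHom X.a Y.a)
        (B.ψ.map V.A W.A ≫ S.tensorHom V.a W.a) ≫ Z.ζ X.A Y.A V.A W.A ≫ S.tensorHom f g := by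
    rw [T.map_comp, Category.assoc, ← reassoc_of% (B.ψ.map_natural f g),
      reassoc_of% (B.interchange X.A Y.A V.A W.A), S.tensorHom_comp_tensorHom,
      S.tensorHom_comp_tensorHom, hf', hg', ← D.tensorHom_comp_tensorHom, Category.assoc,
      reassoc_of% (Z.ζ_natural X.a Y.a V.a W.a), S.tensorHom_comp_tensorHom]
  exact key

theorem isMultilinear_θ :
    B.φ.IsMultilinear [B.ψ.algUnit, B.ψ.algUnit] B.ψ.algUnit Z.θ :=
  MonoidalMonad.isMultilinear_pair.2 B.unit_θ

/-- The unit enters only through a universal nullary map `e`, and the unit maps `δT`, `ζ₀T` only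
through their composites with `e`. -/
theorem exists_duoidal {P : T.Algebra → T.Algebra → T.Algebra} {E : T.Algebra}
    {u : ∀ V W : T.Algebra, D.tensorObj V.A W.A ⟶ (P V W).A} {e : D.tensorUnit ⟶ E.A}
    (hc : B.φ.UniversalMapsCompose)
    (hu : ∀ V W : T.Algebra, B.φ.IsUniversal [V, W] (P V W) (u V W))
    (he : B.φ.IsUniversal [] E e) (N : MonoidalOn P E)
    (hN : IsCompatible (M := D) u e N.toMonoidalData)
    (δT : E ⟶ B.ψ.algTensor E E) (ζ₀T : E ⟶ B.ψ.algUnit)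
    (hδ : e ≫ δT.f = Z.δ ≫ S.tensorHom e e) (hζ₀ : e ≫ ζ₀T.f = Z.ζ₀) :
    ∃ ZT : DuoidalStructure N.toMonoidalCategory B.ψ.algMonoidal,
      (∀ X Y V W : T.Algebra,
        u (B.ψ.algTensor X Y) (B.ψ.algTensor V W) ≫ (ZT.ζ X Y V W).f =
          Z.ζ X.A Y.A V.A W.A ≫ S.tensorHom (u X V) (u Y W)) ∧
      u B.ψ.algUnit B.ψ.algUnit ≫ ZT.θ.f = Z.θ ∧ ZT.δ = δT ∧ ZT.ζ₀ = ζ₀T := by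
  have epi : ∀ V W, AlgEpi (u V W) := fun V W => (hu V W).algEpi
  let t : T.Algebra → T.Algebra → T.Algebra := B.ψ.algTensor
  let J : T.Algebra := B.ψ.algUnit
  let th : ∀ {X X' Y Y' : T.Algebra}, (X ⟶ X') → (Y ⟶ Y') → (t X Y ⟶ t X' Y') :=
    fun f g => B.ψ.algMonoidal.tensorHom f g
  obtain ⟨ζT, hζ⟩ : ∃ ζT : ∀ X Y V W : T.Algebra, P (t X Y) (t V W) ⟶ t (P X V) (P Y W),
      ∀ X Y V W : T.Algebra, u (t X Y) (t V W) ≫ (ζT X Y V W).f =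
          Z.ζ X.A Y.A V.A W.A ≫ S.tensorHom (u X V) (u Y W) :=
    ⟨fun X Y V W => (hu _ _).desc (B.isMultilinear_ζ (hu X V).1 (hu Y W).1),
      fun X Y V W => (hu _ _).fac (B.isMultilinear_ζ (hu X V).1 (hu Y W).1)⟩
  obtain ⟨θT, hθ⟩ : ∃ θT : P J J ⟶ J, u J J ≫ θT.f = Z.θ :=
    ⟨(hu _ _).desc B.isMultilinear_θ, (hu _ _).fac B.isMultilinear_θ⟩
  refine ⟨{ ζ := ζT
            δ := δT
            θ := θT
            ζ₀ := ζ₀T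
            ζ_natural := ?_
            ζ_assoc_left := ?_
            ζ_assoc_right := ?_
            δ_left := ?_
            δ_right := ?_
            θ_left := ?_
            θ_right := ?_
            monoid_assoc := ?_
            monoid_one_mul := ?_
            monoid_mul_one := ?_
            comonoid_coassoc := ?_
            comonoid_counit_left := ?_
            comonoid_counit_right := ?_ }, hζ, hθ, rfl, rfl⟩
  · intro X X' Y Y' V V' W W' f g h k
    apply epi
    have e1 : u (t X Y) (t V W) ≫ (N.toMonoidalData.tensorHom (th f g) (th h k)).f =
        D.tensorHom (S.tensorHom f.f g.f) (S.tensorHom h.f k.f) ≫ u (t X' Y') (t V' W') :=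
      hN.tensorHom (th f g) (th h k)
    change u (t X Y) (t V W) ≫ (N.toMonoidalData.tensorHom (th f g) (th h k)).f ≫
      (ζT X' Y' V' W').f = u (t X Y) (t V W) ≫ (ζT X Y V W).f ≫
        S.tensorHom (N.toMonoidalData.tensorHom f h).f (N.toMonoidalData.tensorHom g k).f
    rw [reassoc_of% e1, hζ, reassoc_of% (hζ X Y V W), S.tensorHom_comp_tensorHom, hN.tensorHom,
      hN.tensorHom, ← S.tensorHom_comp_tensorHom, reassoc_of% (Z.ζ_natural f.f g.f h.f k.f)]
  · intro X₁ Y₁ X₂ Y₂ X₃ Y₃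
    apply IsCompatible.algEpi_assoc hc hu
    change (D.whiskerRight (u (t X₁ Y₁) (t X₂ Y₂)) (S.tensorObj X₃.A Y₃.A) ≫
        u (P (t X₁ Y₁) (t X₂ Y₂)) (t X₃ Y₃)) ≫
        (N.whiskerRight (ζT X₁ Y₁ X₂ Y₂) (t X₃ Y₃)).f ≫
        (ζT (P X₁ X₂) (P Y₁ Y₂) X₃ Y₃).f ≫
        S.tensorHom (N.associator X₁ X₂ X₃).hom.f (N.associator Y₁ Y₂ Y₃).hom.f =
      (D.whiskerRight (u (t X₁ Y₁) (t X₂ Y₂)) (t X₃ Y₃).A ≫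
        u (P (t X₁ Y₁) (t X₂ Y₂)) (t X₃ Y₃)) ≫
        (N.associator (t X₁ Y₁) (t X₂ Y₂) (t X₃ Y₃)).hom.f ≫
        (N.whiskerLeft (t X₁ Y₁) (ζT X₂ Y₂ X₃ Y₃)).f ≫
        (ζT X₁ Y₁ (P X₂ X₃) (P Y₂ Y₃)).f
    -- Compatibility is restated with underlying objects of `⋆`-products written in `C`, so that
    -- rewriting can match them.
    have e1 : u (P (t X₁ Y₁) (t X₂ Y₂)) (t X₃ Y₃) ≫
        (N.whiskerRight (ζT X₁ Y₁ X₂ Y₂) (t X₃ Y₃)).f =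
        D.whiskerRight (ζT X₁ Y₁ X₂ Y₂).f (S.tensorObj X₃.A Y₃.A) ≫
          u (t (P X₁ X₂) (P Y₁ Y₂)) (t X₃ Y₃) := hN.whiskerRight _ _
    have e2 : u (t X₁ Y₁) (P (t X₂ Y₂) (t X₃ Y₃)) ≫
        (N.whiskerLeft (t X₁ Y₁) (ζT X₂ Y₂ X₃ Y₃)).f =
        D.whiskerLeft (S.tensorObj X₁.A Y₁.A) (ζT X₂ Y₂ X₃ Y₃).f ≫
          u (t X₁ Y₁) (t (P X₂ X₃) (P Y₂ Y₃)) := hN.whiskerLeft _ _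
    have e3 : D.whiskerRight (u (t X₁ Y₁) (t X₂ Y₂)) (t X₃ Y₃).A ≫
        u (P (t X₁ Y₁) (t X₂ Y₂)) (t X₃ Y₃) ≫
          (N.associator (t X₁ Y₁) (t X₂ Y₂) (t X₃ Y₃)).hom.f =
        (D.associator (S.tensorObj X₁.A Y₁.A) (S.tensorObj X₂.A Y₂.A)
          (S.tensorObj X₃.A Y₃.A)).hom ≫
          D.whiskerLeft (S.tensorObj X₁.A Y₁.A) (u (t X₂ Y₂) (t X₃ Y₃)) ≫
            u (t X₁ Y₁) (P (t X₂ Y₂) (t X₃ Y₃)) := hN.associator _ _ _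
    -- Naturality of `ζ` moves all the maps `u` behind it, where associativity of `ζ` in `C`
    -- applies.
    rw [Category.assoc, Category.assoc, reassoc_of% e1, reassoc_of% e3, reassoc_of% e2,
      reassoc_of% (hζ (P X₁ X₂) (P Y₁ Y₂) X₃ Y₃), hζ, S.tensorHom_comp_tensorHom,
      ← @MonoidalCategory.comp_whiskerRight_assoc C _ D,
      ← @MonoidalCategory.whiskerLeft_comp_assoc C _ D, hζ, hζ,
      @MonoidalCategory.comp_whiskerRight_assoc C _ D,
      @MonoidalCategory.whiskerLeft_comp_assoc C _ D,
      reassoc_of% (Z.ζ_natural_right (u X₁ X₂) (u Y₁ Y₂) X₃.A Y₃.A),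
      reassoc_of% (Z.ζ_natural_left X₁.A Y₁.A (u X₂ X₃) (u Y₂ Y₃)),
      S.tensorHom_comp_tensorHom, S.tensorHom_comp_tensorHom, hN.associator, hN.associator,
      ← S.tensorHom_comp_tensorHom, reassoc_of% (Z.ζ_assoc_left X₁.A Y₁.A X₂.A Y₂.A X₃.A Y₃.A)]
  · intro X₁ X₂ X₃ Y₁ Y₂ Y₃
    apply epi
    have e1 : u (t (t X₁ X₂) X₃) (t (t Y₁ Y₂) Y₃) ≫
        (N.toMonoidalData.tensorHom (B.ψ.algMonoidal.associator X₁ X₂ X₃).hom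
          (B.ψ.algMonoidal.associator Y₁ Y₂ Y₃).hom).f =
        D.tensorHom (S.associator X₁.A X₂.A X₃.A).hom (S.associator Y₁.A Y₂.A Y₃.A).hom ≫
          u (t X₁ (t X₂ X₃)) (t Y₁ (t Y₂ Y₃)) := hN.tensorHom _ _
    have e2 := hζ (t X₁ X₂) X₃ (t Y₁ Y₂) Y₃
    have e3 := hζ X₁ (t X₂ X₃) Y₁ (t Y₂ Y₃)
    change u (t (t X₁ X₂) X₃) (t (t Y₁ Y₂) Y₃) ≫ (ζT (t X₁ X₂) X₃ (t Y₁ Y₂) Y₃).f ≫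
        S.whiskerRight (ζT X₁ X₂ Y₁ Y₂).f (P X₃ Y₃).A ≫
        (S.associator (P X₁ Y₁).A (P X₂ Y₂).A (P X₃ Y₃).A).hom =
      u (t (t X₁ X₂) X₃) (t (t Y₁ Y₂) Y₃) ≫
        (N.toMonoidalData.tensorHom (B.ψ.algMonoidal.associator X₁ X₂ X₃).hom
          (B.ψ.algMonoidal.associator Y₁ Y₂ Y₃).hom).f ≫
        (ζT X₁ (t X₂ X₃) Y₁ (t Y₂ Y₃)).f ≫
        S.whiskerLeft (P X₁ Y₁).A (ζT X₂ X₃ Y₂ Y₃).f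
    rw [reassoc_of% e1, reassoc_of% e2, reassoc_of% e3,
      @MonoidalCategory.tensorHom_comp_whiskerRight_assoc C _ S,
      @MonoidalCategory.tensorHom_comp_whiskerLeft C _ S, hζ, hζ,
      ← @MonoidalCategory.whiskerRight_comp_tensorHom_assoc C _ S,
      ← @MonoidalCategory.whiskerLeft_comp_tensorHom C _ S,
      S.associator_naturality, reassoc_of% (Z.ζ_assoc_right X₁.A X₂.A X₃.A Y₁.A Y₂.A Y₃.A)]
  · intro X Y
    apply IsCompatible.algEpi_left hc hu he
    have e1 : u E (t X Y) ≫ (N.whiskerRight δT (t X Y)).f =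
        D.whiskerRight δT.f (S.tensorObj X.A Y.A) ≫ u (t E E) (t X Y) := hN.whiskerRight _ _
    have e2 := hN.leftUnitor (t X Y)
    change (D.whiskerRight e (S.tensorObj X.A Y.A) ≫ u E (t X Y)) ≫
      (N.whiskerRight δT (t X Y)).f ≫ (ζT E E X Y).f ≫
        S.tensorHom (N.leftUnitor X).hom.f (N.leftUnitor Y).hom.f =
      (D.whiskerRight e (t X Y).A ≫ u E (t X Y)) ≫ (N.leftUnitor (t X Y)).hom.f
    -- By `hδ`, `e ≫ δT` becomes `δ` followed by two copies of `e`, one for each of the left unitors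
    -- of `X` and `Y`.
    rw [Category.assoc, Category.assoc, e2, reassoc_of% e1, reassoc_of% (hζ E E X Y),
      ← @MonoidalCategory.comp_whiskerRight_assoc C _ D, hδ,
      @MonoidalCategory.comp_whiskerRight_assoc C _ D,
      reassoc_of% (Z.ζ_natural_right e e X.A Y.A), S.tensorHom_comp_tensorHom,
      S.tensorHom_comp_tensorHom, hN.leftUnitor, hN.leftUnitor]
    exact Z.δ_left X.A Y.A
  · intro X Y
    apply IsCompatible.algEpi_right hc hu he
    have e1 : u (t X Y) E ≫ (N.whiskerLeft (t X Y) δT).f =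
        D.whiskerLeft (S.tensorObj X.A Y.A) δT.f ≫ u (t X Y) (t E E) := hN.whiskerLeft _ _
    have e2 := hN.rightUnitor (t X Y)
    change (D.whiskerLeft (S.tensorObj X.A Y.A) e ≫ u (t X Y) E) ≫
      (N.whiskerLeft (t X Y) δT).f ≫ (ζT X Y E E).f ≫
        S.tensorHom (N.rightUnitor X).hom.f (N.rightUnitor Y).hom.f =
      (D.whiskerLeft (t X Y).A e ≫ u (t X Y) E) ≫ (N.rightUnitor (t X Y)).hom.f
    rw [Category.assoc, Category.assoc, e2, reassoc_of% e1, reassoc_of% (hζ X Y E E),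
      ← @MonoidalCategory.whiskerLeft_comp_assoc C _ D, hδ,
      @MonoidalCategory.whiskerLeft_comp_assoc C _ D,
      reassoc_of% (Z.ζ_natural_left X.A Y.A e e), S.tensorHom_comp_tensorHom,
      S.tensorHom_comp_tensorHom, hN.rightUnitor, hN.rightUnitor]
    exact Z.δ_right X.A Y.A
  · intro X Y
    apply epi
    have e1 : u (t J X) (t J Y) ≫ (N.toMonoidalData.tensorHom
        (B.ψ.algMonoidal.leftUnitor X).hom (B.ψ.algMonoidal.leftUnitor Y).hom).f =
        D.tensorHom (S.leftUnitor X.A).hom (S.leftUnitor Y.A).hom ≫ u X Y := hN.tensorHom _ _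
    have e2 := hζ J X J Y
    change u (t J X) (t J Y) ≫ (ζT J X J Y).f ≫ S.whiskerRight θT.f (P X Y).A ≫
        (S.leftUnitor (P X Y).A).hom =
      u (t J X) (t J Y) ≫ (N.toMonoidalData.tensorHom
        (B.ψ.algMonoidal.leftUnitor X).hom (B.ψ.algMonoidal.leftUnitor Y).hom).f
    rw [e1, reassoc_of% e2, @MonoidalCategory.tensorHom_comp_whiskerRight_assoc C _ S, hθ,
      S.tensorHom_def, Category.assoc, S.leftUnitor_naturality,
      reassoc_of% (Z.θ_left X.A Y.A)]
  · intro X Y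
    apply epi
    have e1 : u (t X J) (t Y J) ≫ (N.toMonoidalData.tensorHom
        (B.ψ.algMonoidal.rightUnitor X).hom (B.ψ.algMonoidal.rightUnitor Y).hom).f =
        D.tensorHom (S.rightUnitor X.A).hom (S.rightUnitor Y.A).hom ≫ u X Y := hN.tensorHom _ _
    have e2 := hζ X J Y J
    change u (t X J) (t Y J) ≫ (ζT X J Y J).f ≫ S.whiskerLeft (P X Y).A θT.f ≫
        (S.rightUnitor (P X Y).A).hom =
      u (t X J) (t Y J) ≫ (N.toMonoidalData.tensorHom
        (B.ψ.algMonoidal.rightUnitor X).hom (B.ψ.algMonoidal.rightUnitor Y).hom).f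
    rw [e1, reassoc_of% e2, @MonoidalCategory.tensorHom_comp_whiskerLeft_assoc C _ S, hθ,
      @MonoidalCategory.tensorHom_def' C _ S, Category.assoc, S.rightUnitor_naturality,
      reassoc_of% (Z.θ_right X.A Y.A)]
  · apply IsCompatible.algEpi_assoc hc hu
    change (D.whiskerRight (u J J) J.A ≫ u (P J J) J) ≫ (N.whiskerRight θT J).f ≫ θT.f =
      (D.whiskerRight (u J J) J.A ≫ u (P J J) J) ≫ (N.associator J J J).hom.f ≫
        (N.whiskerLeft J θT).f ≫ θT.f
    rw [Category.assoc, Category.assoc, reassoc_of% (hN.whiskerRight θT J),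
      reassoc_of% (hN.associator J J J), reassoc_of% (hN.whiskerLeft J θT), hθ,
      ← @MonoidalCategory.comp_whiskerRight_assoc C _ D,
      ← @MonoidalCategory.whiskerLeft_comp_assoc C _ D, hθ]
    exact Z.monoid_assoc
  · apply IsCompatible.algEpi_left hc hu he
    change (D.whiskerRight e J.A ≫ u E J) ≫ (N.whiskerRight ζ₀T J).f ≫ θT.f =
      (D.whiskerRight e J.A ≫ u E J) ≫ (N.leftUnitor J).hom.f
    rw [Category.assoc, Category.assoc, reassoc_of% (hN.whiskerRight ζ₀T J), hN.leftUnitor, hθ,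
      ← @MonoidalCategory.comp_whiskerRight_assoc C _ D, hζ₀]
    exact Z.monoid_one_mul
  · apply IsCompatible.algEpi_right hc hu he
    change (D.whiskerLeft J.A e ≫ u J E) ≫ (N.whiskerLeft J ζ₀T).f ≫ θT.f =
      (D.whiskerLeft J.A e ≫ u J E) ≫ (N.rightUnitor J).hom.f
    rw [Category.assoc, Category.assoc, reassoc_of% (hN.whiskerLeft J ζ₀T), hN.rightUnitor, hθ,
      ← @MonoidalCategory.whiskerLeft_comp_assoc C _ D, hζ₀]
    exact Z.monoid_mul_one
  -- The comonoid axioms concern maps out of `E`, so composing with `e` alone is enough.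
  · apply he.algEpi
    change e ≫ δT.f ≫ S.whiskerRight δT.f E.A ≫ (S.associator E.A E.A E.A).hom =
      e ≫ δT.f ≫ S.whiskerLeft E.A δT.f
    rw [reassoc_of% hδ, reassoc_of% hδ, @MonoidalCategory.tensorHom_comp_whiskerRight_assoc C _ S,
      @MonoidalCategory.tensorHom_comp_whiskerLeft C _ S, hδ,
      ← @MonoidalCategory.whiskerRight_comp_tensorHom_assoc C _ S,
      ← @MonoidalCategory.whiskerLeft_comp_tensorHom C _ S, S.associator_naturality,
      reassoc_of% Z.comonoid_coassoc]
  · apply he.algEpi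
    change e ≫ δT.f ≫ S.whiskerRight ζ₀T.f E.A ≫ (S.leftUnitor E.A).hom = e ≫ 𝟙 E.A
    rw [reassoc_of% hδ, @MonoidalCategory.tensorHom_comp_whiskerRight_assoc C _ S, hζ₀,
      S.tensorHom_def, Category.assoc, S.leftUnitor_naturality,
      reassoc_of% Z.comonoid_counit_left, Category.comp_id]
  · apply he.algEpi
    change e ≫ δT.f ≫ S.whiskerLeft E.A ζ₀T.f ≫ (S.rightUnitor E.A).hom = e ≫ 𝟙 E.A
    rw [reassoc_of% hδ, @MonoidalCategory.tensorHom_comp_whiskerLeft_assoc C _ S, hζ₀,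
      @MonoidalCategory.tensorHom_def' C _ S, Category.assoc, S.rightUnitor_naturality,
      reassoc_of% Z.comonoid_counit_right, Category.comp_id]

/-- The unit map `T I ⟶ T (I ⋆ I) ⟶ T I ⋆ T I` of algebras. -/
def freeδ : T.free.obj D.tensorUnit ⟶
    B.ψ.algTensor (T.free.obj D.tensorUnit) (T.free.obj D.tensorUnit) where
  f := (T.map Z.δ ≫ B.ψ.map D.tensorUnit D.tensorUnit : T.obj D.tensorUnit ⟶ _)
  h := by
    have h : T.μ.app D.tensorUnit ≫ T.map Z.δ = T.map (T.map Z.δ) ≫ T.μ.app _ :=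
      (T.μ.naturality Z.δ).symm
    change T.map (T.map Z.δ ≫ B.ψ.map D.tensorUnit D.tensorUnit) ≫
      B.ψ.map (T.obj D.tensorUnit) (T.obj D.tensorUnit) ≫
        S.tensorHom (T.μ.app D.tensorUnit) (T.μ.app D.tensorUnit) =
      T.μ.app D.tensorUnit ≫ T.map Z.δ ≫ B.ψ.map D.tensorUnit D.tensorUnit
    -- Comonoidality of `μ` is what makes `ψ` a morphism of algebras out of the free algebra.
    rw [reassoc_of% h, B.ψ.mul_map, T.map_comp, Category.assoc]

theorem unit_freeδ : T.η.app D.tensorUnit ≫ B.freeδ.f =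
    Z.δ ≫ S.tensorHom (T.η.app D.tensorUnit) (T.η.app D.tensorUnit) := by
  have h : T.η.app D.tensorUnit ≫ T.map Z.δ = Z.δ ≫ T.η.app _ := (T.η.naturality Z.δ).symm
  change T.η.app D.tensorUnit ≫ T.map Z.δ ≫ B.ψ.map D.tensorUnit D.tensorUnit = _
  rw [reassoc_of% h]
  exact congrArg (Z.δ ≫ ·) (B.ψ.unit_map D.tensorUnit D.tensorUnit)

end BimonoidalMonad

end Duoidal

end DuoidalAlgebras

/-! ### Assembly of the theorem -/

open DuoidalAlgebras
theorem theoremt {C : Type u} [Category.{v} C] (D S : MonoidalCategory C)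
    (Z : DuoidalStructure D S) (T : Monad C) (B : BimonoidalMonad Z T)
    (hex : B.φ.UniversalMapsExist) (hcomp : B.φ.UniversalMapsCompose)
    (P : T.Algebra → T.Algebra → T.Algebra)
    (u : ∀ V W : T.Algebra, D.tensorObj V.A W.A ⟶ (P V W).A)
    (hu : ∀ V W : T.Algebra, B.φ.IsUniversal [V, W] (P V W) (u V W)) :
    ∃ M : MonoidalOn P (T.free.obj D.tensorUnit), IsInduced D u M ∧
      ∃ ZT : DuoidalStructure M.toMonoidalCategory B.ψ.algMonoidal,
        (∀ X Y V W : T.Algebra,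
          u (B.ψ.algTensor X Y) (B.ψ.algTensor V W) ≫ (ZT.ζ X Y V W).f =
            Z.ζ X.A Y.A V.A W.A ≫ S.tensorHom (u X V) (u Y W)) ∧
        u B.ψ.algUnit B.ψ.algUnit ≫ ZT.θ.f = Z.θ ∧
        ZT.δ.f = T.map Z.δ ≫ B.ψ.map D.tensorUnit D.tensorUnit ∧
        ZT.ζ₀.f = T.map Z.ζ₀ ≫ B.ψ.ψ₀ := by
  have he := B.φ.isUniversal_unit
  obtain ⟨N, hN⟩ := IsCompatible.exists_data hcomp hu he
  let M : MonoidalOn P (T.free.obj D.tensorUnit) := ⟨N, hN.isMonoidal hcomp hu he⟩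
  -- The extension of `ζ₀` to the free algebra is by definition `T.map ζ₀` followed by the action
  -- `ψ₀` of `J`, which is the required formula.
  obtain ⟨ZT, h₁, h₂, h₃, h₄⟩ := B.exists_duoidal hcomp hu he M hN B.freeδ
    (MonoidalMonad.unitDesc (W := B.ψ.algUnit) Z.ζ₀) B.unit_freeδ
    (MonoidalMonad.unit_unitDesc (W := B.ψ.algUnit) Z.ζ₀)
  exact ⟨M, ⟨hN.whiskerLeft, hN.whiskerRight, hN.associator, hN.leftUnitor, hN.rightUnitor⟩,
    ZT, h₁, h₂, congrArg Monad.Algebra.Hom.f h₃, congrArg Monad.Algebra.Hom.f h₄⟩
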